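/- **Conventions.** A partial function $F:\subseteq\mathbb N^{\mathbb N}\to\mathbb N^{\mathbb N}$ is computable if a single oracle program computes $F(p)(n)$ from $n$ with oracle $p$, for all $p\in\mathrm{dom}(F)$, $n\in\mathbb N$. Put $\langle p,q\rangle(2k)=p(k)$, $\langle p,q\rangle(2k+1)=q(k)$ and $\langle p_0,p_1,\dots\rangle\langle i,j\rangle=p_i(j)$, where $\langle i,j\rangle$ is a computable pairing of natural numbers. A representation of a set $X$ is a surjective partial map $\delta:\subseteq\mathbb N^{\mathbb N}\to X$, and $p$ is called a name of $\delta(p)$. For a partial multi-valued function $f:\subseteq(X,\delta_X)\rightrightarrows(Y,\delta_Y)$ on represented spaces (with $f(x)\neq\emptyset$ for $x\in\mathrm{dom}(f)$), a realizer $F\vdash f$ is a partial $F:\subseteq\mathbb N^{\mathbb N}\to\mathbb N^{\mathbb N}$ with $\delta_Y F(p)\in f(\delta_X(p))$ for all $p$ with $\delta_X(p)\in\mathrm{dom}(f)$. Write $f\le_{\mathrm W}g$ if there are computable $K,H:\subseteq\mathbb N^{\mathbb N}\to\mathbb N^{\mathbb N}$ such that $H\langle\mathrm{id},GK\rangle\vdash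 f$ for all $G\vdash g$, and $f\le_{\mathrm{sW}}g$ if there are computable $K,H$ such that $HGK\vdash f$ for all $G\vdash g$; $\equiv_{\mathrm{sW}}$ is the equivalence induced by $\le_{\mathrm{sW}}$, and $f<_{\mathrm W}g$ means $f\le_{\mathrm W}g$ and $g\not\le_{\mathrm W}f$. The jump $f'$ is $f$ with the input representation $\delta_X$ replaced by $\delta_X\circ\lim$, where $\lim\langle p_0,p_1,\dots\rangle=\lim_{n}p_n$ is the limit in $\mathbb N^{\mathbb N}$. The space $\mathbb N^{\mathbb N}$ is represented by the identity, $2^{\mathbb N}$ by the inclusion into $\mathbb N^{\mathbb N}$ (a point is its own name), and sequences componentwise through $\langle p_0,p_1,\dots\rangle$. The hyperspaces $\mathcal A_-(2^{\mathbb N})$ and $\mathcal A_+(2^{\mathbb N})$ are the set of closed subsets $A\subseteq 2^{\mathbb N}$, represented as follows. A name of $A\in\mathcal A_-(2^{\mathbb N})$ lists balls (sets $w2^{\mathbb N}$ with $w\in\{0,1\}^*$, or $\emptyset$) whose union is $2^{\mathbb N}\setminus A$. A name of $A\in\mathcal A_+(2^{\mathbb N})$ is a name of a sequence in $2^{\mathbb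 N}\sqcup\{\infty\}$ such that $A$ is the closure in $2^{\mathbb N}$ of the set of its members other than $\infty$ (in names of points of $2^{\mathbb N}\sqcup\{\infty\}$ the first entry tells whether the point is $\infty$). **Problems.** * $\mathsf{BCT}_0:\subseteq\mathcal A_-(2^{\mathbb N})^{\mathbb N}\rightrightarrows2^{\mathbb N}$ and $\mathsf{BCT}_2:\subseteq\mathcal A_+(2^{\mathbb N})^{\mathbb N}\rightrightarrows2^{\mathbb N}$ are both given by $(A_i)_i\mapsto2^{\mathbb N}\setminus\bigcup_iA_i$ on the domain $\{(A_i)_i:\ A_i^\circ=\emptyset\text{ for all }i\}$. * $1\text{-}\mathsf{GEN}:2^{\mathbb N}\rightrightarrows2^{\mathbb N}$, $1\text{-}\mathsf{GEN}(q)=\{p: p\text{ is 1-generic in }q\}$. Here $p$ is 1-generic in $q$ if for every $i\in\mathbb N$ there is a finite prefix $w$ of $p$ with $w2^{\mathbb N}\subseteq U_i^q$ or $w2^{\mathbb N}\cap U_i^q=\emptyset$, where $U_i^q=\{p\in2^{\mathbb N}:\varphi_i^{\langle p,q\rangle}(0)\downarrow\}$ and $\varphi_i^{r}$ is the $i$-th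 partial function computable with oracle $r$. * $\lim_{\mathsf J}:\subseteq\mathbb N^{\mathbb N}\to\mathbb N^{\mathbb N}$, $\langle p_0,p_1,\dots\rangle\mapsto\lim_np_n$ (limit in $\mathbb N^{\mathbb N}$), is restricted to the sequences $(p_n)$ that converge in the jump topology. This is the initial topology on $\mathbb N^{\mathbb N}$ induced by the Turing jump $\mathsf J:\mathbb N^{\mathbb N}\to\mathbb N^{\mathbb N}$, with $\mathsf J(p)(i)=1$ if $\varphi_i^p(0)\downarrow$ and $\mathsf J(p)(i)=0$ otherwise. **Corollary.** $$\mathsf{BCT}_0\le_{\mathrm{sW}}1\text{-}\mathsf{GEN}\le_{\mathrm{sW}}\mathsf{BCT}_2\equiv_{\mathrm{sW}}\mathsf{BCT}_0'\le_{\mathrm{sW}}\textstyle\lim_{\mathsf J},$$ and moreover $\mathsf{BCT}_0<_{\mathrm W}1\text{-}\mathsf{GEN}$ and $\mathsf{BCT}_0'<_{\mathrm W}\lim_{\mathsf J}$. -/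

import Mathlib

open Set Filter Topology

namespace Weihrauch

/-! ### Computability on Baire space -/

/-- Baire space `ℕ^ℕ` (with the product topology). -/
abbrev Baire : Type := ℕ → ℕ

/-- Cantor space `2^ℕ` (with the product topology). -/
abbrev Cantor : Type := ℕ → Bool

/-- Cantor space as a subset of Baire space: the 0-1-sequence of `x`. -/
def Cantor.toBaire (x : Cantor) : Baire := fun n => (x n).toNat

/-- The finite initial segment `p(0) … p(k-1)` of `p`. -/
def initSeg (p : Baire) (k : ℕ) : List ℕ := (List.range k).map p

/-- The partial function `φ_c^p` computed by the program `c` with oracle `p`, in Kleene normal form: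
the program receives the argument `n` together with a finite initial segment of the oracle. The runs
on all initial segments (of length `k`) are dovetailed over all time bounds `t`,
and the result is that of the first run (in the order of the pairs `(k, t)`) that halts. -/
def oracleEval (c : Nat.Partrec.Code) (p : Baire) : ℕ →. ℕ := fun n =>
  Nat.rfindOpt fun s =>
    Nat.Partrec.Code.evaln s.unpair.2 c (Nat.pair (Encodable.encode (initSeg p s.unpair.1)) n)

/-- The Gödel numbering `φ_i^p` of the partial functions computable with oracle `p`. -/
def phi (i : ℕ) (p : Baire) : ℕ →. ℕ := oracleEval (Denumerable.ofNat Nat.Partrec.Code i) p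

/-- A partial function `F` on Baire space is computable if a single program computes `F(p)(n)` from
the input `n` with oracle `p`, for all `p` in the domain of `F` and all `n`. -/
def IsComputable (F : Baire →. Baire) : Prop :=
  ∃ i : ℕ, ∀ p : Baire, ∀ q ∈ F p, ∀ n : ℕ, q n ∈ phi i p n

/-- The pairing `⟨p, q⟩` of two sequences: `p` on the even and `q` on the odd positions. -/
def pair (p q : Baire) : Baire := fun n => if n % 2 = 0 then p (n / 2) else q (n / 2)

/-- The `i`-th component `p_i` of `p = ⟨p_0, p_1, p_2, …⟩`. -/
def row (p : Baire) (i : ℕ) : Baire := fun j => p (Nat.pair i j)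

/-! ### Represented spaces, problems, Weihrauch reducibility -/

/-- A representation of `X`: a surjective partial map `δ` from Baire space to `X`, given by its graph.
`IsName p x` says that `p` is in the domain of `δ` and that `δ(p) = x`. -/
structure Representation (X : Type) where
  IsName : Baire → X → Prop
  unique : ∀ {p x y}, IsName p x → IsName p y → x = y
  surj : ∀ x, ∃ p, IsName p x

/-- A partial multi-valued function `f : ⊆ X ⇉ Y`. -/
structure MultiFun (X Y : Type) where
  dom : Set X
  val : X → Set Y
  nonempty : ∀ x ∈ dom, (val x).Nonempty

/-- A multi-valued function on represented spaces. -/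
structure Problem where
  X : Type
  Y : Type
  inRep : Representation X
  outRep : Representation Y
  f : MultiFun X Y

/-- `F ⊢ f`: the partial function `F` on Baire space is a realizer of `f`. -/
def Realizes (F : Baire →. Baire) (f : Problem) : Prop :=
  ∀ p x, f.inRep.IsName p x → x ∈ f.f.dom → ∃ q ∈ F p, ∃ y ∈ f.f.val x, f.outRep.IsName q y

/-- Weihrauch reducibility `f ≤_W g`. -/
def LeW (f g : Problem) : Prop :=
  ∃ K H : Baire →. Baire, IsComputable K ∧ IsComputable H ∧
    ∀ G : Baire →. Baire, Realizes G g →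
      Realizes (fun p => (K p).bind fun q => (G q).bind fun r => H (pair p r)) f

/-- Strong Weihrauch reducibility `f ≤_sW g`. -/
def LeSW (f g : Problem) : Prop :=
  ∃ K H : Baire →. Baire, IsComputable K ∧ IsComputable H ∧
    ∀ G : Baire →. Baire, Realizes G g →
      Realizes (fun p => (K p).bind fun q => (G q).bind fun r => H r) f

/-- Strong Weihrauch equivalence. -/
def EquivSW (f g : Problem) : Prop := LeSW f g ∧ LeSW g f

/-- Strict Weihrauch reducibility `f <_W g`. -/
def LtW (f g : Problem) : Prop := LeW f g ∧ ¬ LeW g f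

/-! ### Constructions of representations -/

/-- Baire space is represented by the identity. -/
def baireRep : Representation Baire where
  IsName p x := p = x
  unique h h' := h.symm.trans h'
  surj x := ⟨x, rfl⟩

/-- A point of Cantor space is represented by its 0-1-sequence. -/
def cantorRep : Representation Cantor where
  IsName p x := p = x.toBaire
  unique {p x y} h h' := by
    funext n
    have := congrFun (h.symm.trans h') n
    simp only [Cantor.toBaire] at this
    revert this
    cases x n <;> cases y n <;> simp
  surj x := ⟨_, rfl⟩

/-- The representation `δ^ℕ` of `X^ℕ`: `⟨p_0, p_1, …⟩` is a name of `(δ(p_0), δ(p_1), …)`. -/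
def seqRep {X : Type} (δ : Representation X) : Representation (ℕ → X) where
  IsName p x := ∀ i, δ.IsName (row p i) (x i)
  unique h h' := funext fun i => δ.unique (h i) (h' i)
  surj x := by
    choose q hq using fun i => δ.surj (x i)
    refine ⟨fun n => q n.unpair.1 n.unpair.2, fun i => ?_⟩
    have : row (fun n => q n.unpair.1 n.unpair.2) i = q i := by
      funext j
      simp [row]
    rw [this]
    exact hq i

/-- The representation of the coproduct `X ⊔ {∞}` with an isolated dummy point `∞ = none`:
`⟨0, p⟩` is a name of `δ(p)`, and `⟨n, p⟩` with `n ≠ 0` is a name of `∞`. -/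
def optionRep {X : Type} (δ : Representation X) : Representation (Option X) where
  IsName p x := match x with
    | some y => p 0 = 0 ∧ δ.IsName (fun n => p (n + 1)) y
    | none => p 0 ≠ 0
  unique {p x y} h h' := by
    match x, y, h, h' with
    | none, none, _, _ => rfl
    | none, some _, h, h' => exact absurd h'.1 h
    | some _, none, h, h' => exact absurd h.1 h'
    | some _, some _, h, h' => exact congrArg some (δ.unique h.2 h'.2)
  surj x := by
    cases x with
    | none => exact ⟨fun _ => 1, by simp⟩
    | some y =>
      obtain ⟨q, hq⟩ := δ.surj y
      exact ⟨fun n => Nat.casesOn n 0 q, rfl, hq⟩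

/-- The jump `δ' = δ ∘ lim` of a representation: `⟨p_0, p_1, …⟩` is a name of `x` if `(p_n)` converges
in Baire space to a `δ`-name of `x`. -/
def Representation.jump {X : Type} (δ : Representation X) : Representation X where
  IsName p x := ∃ q : Baire, Tendsto (row p) atTop (𝓝 q) ∧ δ.IsName q x
  unique := by
    rintro p x y ⟨q, hq, hx⟩ ⟨r, hr, hy⟩
    obtain rfl := tendsto_nhds_unique hq hr
    exact δ.unique hx hy
  surj x := by
    obtain ⟨q, hq⟩ := δ.surj x
    refine ⟨fun n => q n.unpair.2, q, ?_, hq⟩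
    have : row (fun n => q n.unpair.2) = fun _ => q := by
      funext i j
      simp [row]
    rw [this]
    exact tendsto_const_nhds

/-- The jump `f'` of a problem: the input representation is replaced by its jump. -/
def Problem.jump (f : Problem) : Problem := { f with inRep := f.inRep.jump }

/-! ### Hyperspaces of closed subsets of Cantor space -/

/-- The set `w2^ℕ` of all sequences that extend the word `w`. -/
def wordBall (w : List Bool) : Set Cantor := {x | (List.range w.length).map x = w}

/-- The numbering of the balls of Cantor space, which are the sets `w2^ℕ` and the empty set. -/
def ball : ℕ → Set Cantor
  | 0 => ∅
  | n + 1 => ⋃ w ∈ (Encodable.decode n : Option (List Bool)), wordBall w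

theorem wordBall_map (x : Cantor) (n : ℕ) :
    wordBall ((List.range n).map x) = PiNat.cylinder x n := by
  ext y
  simp [wordBall, PiNat.cylinder]

theorem exists_balls {U : Set Cantor} (hU : IsOpen U) : ∃ p : Baire, U = ⋃ i, ball (p i) := by
  classical
  refine ⟨fun i => if ball i ⊆ U then i else 0, ?_⟩
  apply Subset.antisymm
  · intro x hx
    obtain ⟨n, hn⟩ : ∃ n, PiNat.cylinder x n ⊆ U := by
      obtain ⟨_, ⟨y, n, rfl⟩, hxy, hsub⟩ :=
        (PiNat.isTopologicalBasis_cylinders (fun _ : ℕ => Bool)).exists_subset_of_mem_open hx hU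
      exact ⟨n, by rwa [PiNat.mem_cylinder_iff_eq.1 hxy]⟩
    have hb : ball (Encodable.encode ((List.range n).map x) + 1) = PiNat.cylinder x n := by
      rw [← wordBall_map]
      simp [ball]
    refine mem_iUnion.2 ⟨Encodable.encode ((List.range n).map x) + 1, ?_⟩
    beta_reduce
    rw [if_pos (hb ▸ hn), hb]
    exact PiNat.self_mem_cylinder x n
  · refine iUnion_subset fun i => ?_
    beta_reduce
    split_ifs with h
    · exact h
    · simp [ball]

/-- The representation `ψ_-` of the closed subsets of Cantor space by negative information:
a name of `A` lists balls whose union is the complement of `A`. -/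
def negRep : Representation (TopologicalSpace.Closeds Cantor) where
  IsName p A := (A : Set Cantor) = (⋃ i, ball (p i))ᶜ
  unique h h' := TopologicalSpace.Closeds.ext (h.trans h'.symm)
  surj A := by
    obtain ⟨p, hp⟩ := exists_balls A.isClosed.isOpen_compl
    exact ⟨p, by rw [← hp, compl_compl]⟩

/-- The representation `ψ_+` of the closed subsets of Cantor space by positive information:
a name of `A` is a name of a sequence in `2^ℕ ⊔ {∞}` whose members other than `∞` are dense in `A`. -/
def posRep : Representation (TopologicalSpace.Closeds Cantor) where
  IsName p A := ∃ x : ℕ → Option Cantor, (seqRep (optionRep cantorRep)).IsName p x ∧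
    (A : Set Cantor) = closure {y | ∃ n, x n = some y}
  unique := by
    rintro p A B ⟨x, hx, hA⟩ ⟨y, hy, hB⟩
    obtain rfl := (seqRep (optionRep cantorRep)).unique hx hy
    exact TopologicalSpace.Closeds.ext (hA.trans hB.symm)
  surj A := by
    obtain ⟨t, htA, htc, htd⟩ :=
      (TopologicalSpace.IsSeparable.of_separableSpace (A : Set Cantor)).exists_countable_dense_subset
    have hA : (A : Set Cantor) = closure t :=
      Subset.antisymm htd (closure_minimal htA A.isClosed)
    obtain ⟨x, hx⟩ : ∃ x : ℕ → Option Cantor, t = {y | ∃ n, x n = some y} := by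
      rcases t.eq_empty_or_nonempty with rfl | hne
      · exact ⟨fun _ => none, by simp⟩
      · obtain ⟨x, rfl⟩ := htc.exists_eq_range hne
        exact ⟨fun n => some (x n), by ext; simp⟩
    obtain ⟨p, hp⟩ := (seqRep (optionRep cantorRep)).surj x
    exact ⟨p, x, hp, hx ▸ hA⟩

/-! ### The Baire category theorem on Cantor space -/

/-- The multi-valued map that assigns to a sequence of nowhere dense closed subsets of Cantor space
the points that are in none of them. -/
def bctFun : MultiFun (ℕ → TopologicalSpace.Closeds Cantor) Cantor where
  dom := {A | ∀ i, interior (A i : Set Cantor) = ∅}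
  val A := (⋃ i, (A i : Set Cantor))ᶜ
  nonempty A hA := by
    rw [compl_iUnion]
    exact (dense_iInter_of_isOpen (fun i => (A i).isClosed.isOpen_compl)
      fun i => interior_eq_empty_iff_dense_compl.1 (hA i)).nonempty

/-- `BCT_0` on Cantor space: the closed sets are given by negative information. -/
def BCT0 : Problem where
  X := ℕ → TopologicalSpace.Closeds Cantor
  Y := Cantor
  inRep := seqRep negRep
  outRep := cantorRep
  f := bctFun

/-- `BCT_2` on Cantor space: the closed sets are given by positive information. -/
def BCT2 : Problem where
  X := ℕ → TopologicalSpace.Closeds Cantor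
  Y := Cantor
  inRep := seqRep posRep
  outRep := cantorRep
  f := bctFun

/-! ### 1-genericity -/

/-- The `i`-th subset `U_i^q` of Cantor space that is c.e. open in `q`. -/
def ceOpen (q : Cantor) (i : ℕ) : Set Cantor := {p | (phi i (pair p.toBaire q.toBaire) 0).Dom}

/-- `p` is 1-generic in `q`: for every `i` some initial segment `w` of `p` satisfies `w2^ℕ ⊆ U_i^q`
or `w2^ℕ ∩ U_i^q = ∅` (here `PiNat.cylinder p n` is `w2^ℕ` for the `w` of length `n`). -/
def OneGenericIn (q p : Cantor) : Prop :=
  ∀ i, ∃ n, PiNat.cylinder p n ⊆ ceOpen q i ∨ PiNat.cylinder p n ∩ ceOpen q i = ∅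

theorem oracleEval_dom {c : Nat.Partrec.Code} {p : Baire} {n : ℕ} :
    (oracleEval c p n).Dom ↔
      ∃ k, (c.eval (Nat.pair (Encodable.encode (initSeg p k)) n)).Dom := by
  rw [oracleEval, Nat.rfindOpt_dom]
  constructor
  · rintro ⟨s, a, ha⟩
    exact ⟨s.unpair.1, Part.dom_iff_mem.2 ⟨a, Nat.Partrec.Code.evaln_sound ha⟩⟩
  · rintro ⟨k, hk⟩
    obtain ⟨a, ha⟩ := Part.dom_iff_mem.1 hk
    obtain ⟨t, ht⟩ := Nat.Partrec.Code.evaln_complete.1 ha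
    exact ⟨Nat.pair k t, a, by simpa using ht⟩

theorem isOpen_ceOpen (q : Cantor) (i : ℕ) : IsOpen (ceOpen q i) := by
  rw [(PiNat.isTopologicalBasis_cylinders (fun _ : ℕ => Bool)).isOpen_iff]
  intro p hp
  obtain ⟨k, hk⟩ := oracleEval_dom.1 hp
  refine ⟨PiNat.cylinder p k, ⟨p, k, rfl⟩, PiNat.self_mem_cylinder p k, fun r hr => ?_⟩
  refine oracleEval_dom.2 ⟨k, ?_⟩
  have : initSeg (pair (Cantor.toBaire r) q.toBaire) k =
      initSeg (pair (Cantor.toBaire p) q.toBaire) k := by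
    refine List.map_congr_left fun m hm => ?_
    have hm' : m / 2 < k := lt_of_le_of_lt (Nat.div_le_self m 2) (List.mem_range.1 hm)
    simp only [pair, Cantor.toBaire]
    rw [hr (m / 2) hm']
  rwa [this]

theorem exists_oneGenericIn (q : Cantor) : ∃ p, OneGenericIn q p := by
  have hd : Dense (⋂ i, (ceOpen q i ∪ (closure (ceOpen q i))ᶜ)) := by
    refine dense_iInter_of_isOpen
      (fun i => (isOpen_ceOpen q i).union isClosed_closure.isOpen_compl) fun i => ?_
    rw [dense_iff_closure_eq, closure_union, eq_univ_iff_forall]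
    intro x
    by_cases hx : x ∈ closure (ceOpen q i)
    · exact Or.inl hx
    · exact Or.inr (subset_closure hx)
  obtain ⟨p, hp⟩ := hd.nonempty
  have key : ∀ U : Set Cantor, IsOpen U → p ∈ U → ∃ n, PiNat.cylinder p n ⊆ U := by
    intro U hU hpU
    obtain ⟨_, ⟨y, n, rfl⟩, hpy, hsub⟩ :=
      (PiNat.isTopologicalBasis_cylinders (fun _ : ℕ => Bool)).exists_subset_of_mem_open hpU hU
    exact ⟨n, by rwa [PiNat.mem_cylinder_iff_eq.1 hpy]⟩
  refine ⟨p, fun i => ?_⟩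
  rcases mem_iInter.1 hp i with h | h
  · obtain ⟨n, hn⟩ := key _ (isOpen_ceOpen q i) h
    exact ⟨n, Or.inl hn⟩
  · obtain ⟨n, hn⟩ := key _ isClosed_closure.isOpen_compl h
    refine ⟨n, Or.inr (eq_empty_of_forall_notMem fun r hr => hn hr.1 (subset_closure hr.2))⟩

/-- The problem `1-GEN` of 1-genericity. -/
def oneGEN : Problem where
  X := Cantor
  Y := Cantor
  inRep := cantorRep
  outRep := cantorRep
  f :=
    { dom := univ
      val := fun q => {p | OneGenericIn q p}
      nonempty := fun q _ => exists_oneGenericIn q }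

/-! ### The limit with respect to the jump topology -/

open Classical in
/-- The Turing jump operator `J` on Baire space. -/
noncomputable def turingJump (p : Baire) : Baire := fun i => if (phi i p 0).Dom then 1 else 0

/-- The jump topology on Baire space: the initial topology induced by `J`. -/
@[reducible] noncomputable def jumpTopology : TopologicalSpace Baire :=
  TopologicalSpace.induced turingJump Pi.topologicalSpace

theorem exists_phi_dom_iff (a b : ℕ) : ∃ i, ∀ p : Baire, (phi i p 0).Dom ↔ p a = b := by
  have hc : Computable fun m : ℕ =>
      decide (((Denumerable.ofNat (List ℕ) m.unpair.1)[a]?) = some b) := by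
    have h1 : Primrec fun m : ℕ => (Denumerable.ofNat (List ℕ) m.unpair.1)[a]? :=
      Primrec.list_getElem?.comp ((Primrec.ofNat (List ℕ)).comp (Primrec.fst.comp Primrec.unpair))
        (Primrec.const a)
    have h2 : PrimrecPred fun m : ℕ =>
        (Denumerable.ofNat (List ℕ) m.unpair.1)[a]? = some b :=
      Primrec.eq.comp h1 (Primrec.const (some b))
    exact h2.decide.to_comp
  have hp : Partrec fun m : ℕ =>
      cond (decide (((Denumerable.ofNat (List ℕ) m.unpair.1)[a]?) = some b))
        (Part.some 0 : Part ℕ) Part.none :=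
    Partrec.cond hc (Computable.const 0).partrec Partrec.none
  obtain ⟨c, hcode⟩ := Nat.Partrec.Code.exists_code.1 (Partrec.nat_iff.1 hp)
  refine ⟨Encodable.encode c, fun p => ?_⟩
  rw [phi, Denumerable.ofNat_encode, oracleEval_dom]
  simp only [hcode, Nat.unpair_pair, Denumerable.ofNat_encode]
  constructor
  · rintro ⟨k, hk⟩
    by_cases h : (initSeg p k)[a]? = some b
    · simp only [initSeg, List.getElem?_map, Option.map_eq_some_iff] at h
      obtain ⟨m, hm, hb⟩ := h
      have : a = m := by
        rw [List.getElem?_eq_some_iff] at hm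
        obtain ⟨_, hm⟩ := hm
        simpa using hm
      rw [this, hb]
    · simp [h] at hk
  · intro h
    refine ⟨a + 1, ?_⟩
    have : (initSeg p (a + 1))[a]? = some b := by simp [initSeg, h]
    simp [this]

/-- Convergence in the jump topology implies convergence in Baire space. -/
theorem tendsto_of_jump {u : ℕ → Baire} {x : Baire}
    (h : Tendsto u atTop (@nhds Baire jumpTopology x)) : Tendsto u atTop (𝓝 x) := by
  rw [jumpTopology, nhds_induced, tendsto_comap_iff, tendsto_pi_nhds] at h
  rw [tendsto_pi_nhds]
  intro a
  obtain ⟨i, hi⟩ := exists_phi_dom_iff a (x a)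
  have h1 := h i
  rw [nhds_discrete, tendsto_pure] at h1 ⊢
  filter_upwards [h1] with n hn
  simpa [turingJump, hi] using hn

/-- `lim_J`: the limit map `⟨p_0, p_1, …⟩ ↦ lim p_n` of Baire space, restricted to the sequences that
converge with respect to the jump topology. -/
def limJ : Problem where
  X := Baire
  Y := Baire
  inRep := baireRep
  outRep := baireRep
  f :=
    { dom := {p | ∃ x, Tendsto (row p) atTop (@nhds Baire jumpTopology x)}
      val := fun p => {x | Tendsto (row p) atTop (𝓝 x)}
      nonempty := fun _ ⟨x, hx⟩ => ⟨x, tendsto_of_jump hx⟩ }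

end Weihrauch

/-!
All positive reductions hand on the answer unchanged, so each of them amounts to a translation of names
(`Preprocesses`). The translations depend on finite initial segments of bounded length
(`PrefixComputable`), which makes them computable and closed under composition.

* `BCT_0 ≤ 1-GEN`: the complements of the given closed sets are c.e. open relative to the graph of the
  name, and a 1-generic point is in every dense c.e. open set.
* `1-GEN ≤ BCT_0'`: `p` is 1-generic in `q` if and only if it is not on the boundary of any `U_i^q`
  (`oneGenericIn_iff_boundaryName`). Negative names of these boundaries are limits of computable
  stages that list a ball if it is seen to be included in `U_i^q` or not yet seen to meet it.
* `BCT_2 ≤ BCT_0'`: a ball is listed as long as no member of the given sequence is seen in it.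
* `BCT_0' ≤ BCT_2`: a dense open set `U` given by a limit of names is described by the words `v` such
  that some entry at a position `≤ |v|` is a ball that includes `v2^ℕ` at all stages `≥ |v|`. These stable
  words are closed under extensions, and the unstable ones can be enumerated. The closure of
  `{v000… | v unstable}` contains the complement of `U`, and it is nowhere dense, because it misses
  the ball of `v1` for each stable `v`.
* `BCT_0' ≤ lim_J`: the greedy proof of the Baire category theorem is a computable function of negative
  names, so from a convergent sequence of names one computes a sequence of points that converges to a
  solution. The boundaries of the c.e. open sets are added to the given closed sets; then the
  solution is 1-generic, and convergence to a 1-generic point is convergence in the jump topology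
  (`OneGenericIn.tendsto_jump`).

For the separations, 1-generic points are not computable. Since computable instances of `BCT_0` have
computable solutions (the greedy construction again), `1-GEN` is not reducible to `BCT_0`. The
reduction of `BCT_0'` to `lim_J` also yields a computable instance of `lim_J` whose limit `y` is 1-generic.
If `lim_J` were reducible to `BCT_0'`, then `y` would be computed from each solution `x` of an instance of
`BCT_0'`. By the Baire category theorem, `x` can be chosen off the boundary of the open set of all
oracles from which the reduction computes a value different from one of `y` (`wrongSet`). Hence no
extension of some initial segment of `x` leads to a wrong value, and `y` is computable by a search
among these extensions (`computable_of_disjoint_wrongSet`), a contradiction.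
-/

namespace Weihrauch

open Nat.Partrec (Code)
open Nat.Partrec.Code (evaln)

/-! ### Initial segments and the use principle -/

@[simp] theorem length_initSeg (p : Baire) (k : ℕ) : (initSeg p k).length = k := by
  simp [initSeg]

theorem getElem?_initSeg (p : Baire) (k m : ℕ) :
    (initSeg p k)[m]? = if m < k then some (p m) else none := by
  rw [initSeg, List.getElem?_map]
  split_ifs with h
  · simp [List.getElem?_range h]
  · simp [not_lt.1 h]

theorem getElem?_initSeg_eq_some {p : Baire} {k m a : ℕ} :
    (initSeg p k)[m]? = some a ↔ m < k ∧ p m = a := by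
  rw [getElem?_initSeg]
  split_ifs with h <;> simp [h]

theorem getD_initSeg {p : Baire} {k m : ℕ} (h : m < k) (d : ℕ) :
    (initSeg p k).getD m d = p m := by
  rw [List.getD_eq_getElem?_getD, getElem?_initSeg, if_pos h, Option.getD_some]

theorem initSeg_congr {p q : Baire} {k : ℕ} (h : ∀ m < k, p m = q m) :
    initSeg p k = initSeg q k :=
  List.map_congr_left fun m hm => h m (List.mem_range.1 hm)

theorem initSeg_succ (p : Baire) (k : ℕ) : initSeg p (k + 1) = initSeg p k ++ [p k] := by
  simp [initSeg, List.range_succ]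

theorem take_initSeg (p : Baire) {k l : ℕ} (h : k ≤ l) :
    (initSeg p l).take k = initSeg p k := by
  simp [initSeg, ← List.map_take, List.take_range, h]

theorem mem_rfindOpt {α : Type*} {f : ℕ → Option α} {a : α} :
    a ∈ Nat.rfindOpt f ↔ ∃ s, f s = some a ∧ ∀ t < s, f t = none := by
  rw [Nat.rfindOpt, Part.mem_bind_iff]
  constructor
  · rintro ⟨s, h, hs⟩
    refine ⟨s, Part.mem_coe.1 hs, fun t ht => ?_⟩
    have := Nat.rfind_min h ht
    exact Option.not_isSome_iff_eq_none.1 (by rw [← Part.mem_some_iff.1 this]; exact Bool.noConfusion)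
  · rintro ⟨s, hs, h⟩
    refine ⟨s, Nat.mem_rfind.2 ⟨?_, fun {t} ht => ?_⟩, Part.mem_coe.2 hs⟩
    · simp only [hs]
      exact Part.mem_some _
    · simp only [h t ht]
      exact Part.mem_some _

/-- The use principle: a value of a computation with an oracle depends on a finite initial segment
of the oracle only. -/
theorem phi_use {i n a : ℕ} {p : Baire} (h : a ∈ phi i p n) :
    ∃ k, ∀ q : Baire, (∀ m < k, p m = q m) → a ∈ phi i q n := by
  obtain ⟨s, hs, hlt⟩ := mem_rfindOpt.1 h
  refine ⟨s, fun q hq => mem_rfindOpt.2 ⟨s, ?_, fun t ht => ?_⟩⟩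
  · rwa [← initSeg_congr fun m hm => hq m (hm.trans_le (Nat.unpair_left_le s))]
  · rw [← initSeg_congr fun m hm => hq m (hm.trans_le ((Nat.unpair_left_le t).trans ht.le))]
    exact hlt t ht

/-- Halting of a computation with an oracle is halting within some time bound on some initial segment
of the oracle. -/
theorem phi_dom_iff {i n : ℕ} {p : Baire} : (phi i p n).Dom ↔
    ∃ k t, (evaln t (Denumerable.ofNat Code i)
      (Nat.pair (Encodable.encode (initSeg p k)) n)).isSome := by
  rw [phi, oracleEval, Nat.rfindOpt_dom]
  constructor
  · rintro ⟨s, a, h⟩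
    exact ⟨_, _, Option.isSome_iff_exists.2 ⟨a, h⟩⟩
  · rintro ⟨k, t, h⟩
    obtain ⟨a, ha⟩ := Option.isSome_iff_exists.1 h
    exact ⟨Nat.pair k t, a, by simpa using ha⟩

theorem computable_initSeg {α : Type*} [Primcodable α] {P : α → Baire} (hP : Computable₂ P) :
    Computable₂ fun a k => initSeg (P a) k := by
  have : Computable fun x : α × ℕ => Nat.rec (motive := fun _ => List ℕ) []
      (fun k l => l ++ [P x.1 k]) x.2 := by
    refine Computable.nat_rec (h := fun (x : α × ℕ) (y : ℕ × List ℕ) => y.2 ++ [P x.1 y.1])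
      Computable.snd (Computable.const []) ?_
    exact Computable.list_concat.comp (Computable.snd.comp Computable.snd)
      (hP.comp (Computable.fst.comp Computable.fst) (Computable.fst.comp Computable.snd))
  refine this.of_eq fun x => ?_
  obtain ⟨a, k⟩ := x
  induction k with
  | zero => rfl
  | succ k ih => exact (congrArg (· ++ [P a k]) ih).trans (initSeg_succ _ _).symm

/-- Computations with a computable oracle are computable, uniformly in the oracle. -/
theorem phi_partrec {α : Type*} [Primcodable α] {P : α → Baire} (hP : Computable₂ P) (i : ℕ) :
    Partrec₂ fun a n => phi i (P a) n := by
  unfold phi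
  generalize Denumerable.ofNat Code i = c
  have hs : Computable fun y : (α × ℕ) × ℕ => y.2.unpair := Computable.unpair.comp Computable.snd
  have hL : Computable fun y : (α × ℕ) × ℕ => initSeg (P y.1.1) y.2.unpair.1 :=
    (computable_initSeg hP).comp (Computable.fst.comp Computable.fst) (Computable.fst.comp hs)
  have hN : Computable fun y : (α × ℕ) × ℕ =>
      Nat.pair (Encodable.encode (initSeg (P y.1.1) y.2.unpair.1)) y.1.2 :=
    Primrec₂.natPair.to_comp.comp (Computable.encode.comp hL)
      (Computable.snd.comp Computable.fst)
  have hA : Computable fun y : (α × ℕ) × ℕ => ((y.2.unpair.2, c),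
      Nat.pair (Encodable.encode (initSeg (P y.1.1) y.2.unpair.1)) y.1.2) :=
    ((Computable.snd.comp hs).pair (Computable.const c)).pair hN
  have hE := Nat.Partrec.Code.primrec_evaln.to_comp.comp hA
  exact Partrec.rfindOpt hE.to₂

/-- A computable partial function maps computable points to computable points. -/
theorem IsComputable.computable_value {F : Baire →. Baire} (hF : IsComputable F) {p q : Baire}
    (hp : Computable p) (hq : q ∈ F p) : Computable q := by
  obtain ⟨i, hi⟩ := hF
  have := (phi_partrec (P := fun _ : Unit => p) (hp.comp Computable.snd).to₂ i).comp
    (Computable.const ()) Computable.id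
  exact Partrec.of_eq_tot this fun n => hi p q hq n

theorem computable_pair {p q : Baire} (hp : Computable p) (hq : Computable q) :
    Computable (pair p q) := by
  have h2 : Computable fun n : ℕ => n / 2 := (Primrec.nat_div.comp .id (.const 2)).to_comp
  have hm : Computable fun n : ℕ => decide (n % 2 = 0) :=
    (Primrec.eq.comp (Primrec.nat_mod.comp .id (.const 2)) (.const 0)).decide.to_comp
  refine (Computable.cond hm (hp.comp h2) (hq.comp h2)).of_eq fun n => ?_
  by_cases h : n % 2 = 0 <;> simp [pair, h]

/-- The halting of a computation with an oracle may be any decidable property of initial segments of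
the oracle. -/
theorem exists_index {R : List ℕ → Prop} (hR : ComputablePred R) :
    ∃ e, ∀ p : Baire, (phi e p 0).Dom ↔ ∃ k, R (initSeg p k) := by
  obtain ⟨_, hR⟩ := hR
  have hc : Computable fun m : ℕ => decide (R (Denumerable.ofNat (List ℕ) m.unpair.1)) :=
    hR.comp ((Computable.ofNat _).comp (Computable.fst.comp Computable.unpair))
  have hp : Partrec fun m : ℕ => cond (decide (R (Denumerable.ofNat (List ℕ) m.unpair.1)))
      (Part.some 0 : Part ℕ) Part.none :=
    Partrec.cond hc (Computable.const 0).partrec Partrec.none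
  obtain ⟨c, hcode⟩ := Nat.Partrec.Code.exists_code.1 (Partrec.nat_iff.1 hp)
  refine ⟨Encodable.encode c, fun p => ?_⟩
  rw [phi, Denumerable.ofNat_encode, oracleEval_dom]
  refine exists_congr fun k => ?_
  rw [hcode]
  by_cases h : R (initSeg p k) <;> simp [h]

/-! ### Functionals with primitive recursive use -/

/-- A total functional on Baire space whose value at `n` is a primitive recursive function of `n` and
of an initial segment of the argument, the length of which is a primitive recursive function
of `n`. All pre-processing functions of the reductions below are of this kind. -/
def PrefixComputable (K : Baire → Baire) : Prop :=
  ∃ (u : ℕ → ℕ) (g : List ℕ → ℕ → ℕ), Primrec u ∧ Monotone u ∧ Primrec₂ g ∧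
    ∀ p n, K p n = g (initSeg p (u n)) n

theorem PrefixComputable.isComputable {K : Baire → Baire} (hK : PrefixComputable K) :
    IsComputable fun p => Part.some (K p) := by
  obtain ⟨u, g, hu, -, hg, hK⟩ := hK
  -- The program answers on initial segments of the exact length `u n` only, so that the first
  -- halting run has the correct result.
  have hτ : Primrec fun m : ℕ => Denumerable.ofNat (List ℕ) m.unpair.1 :=
    (Primrec.ofNat _).comp (Primrec.fst.comp Primrec.unpair)
  have hn : Primrec fun m : ℕ => m.unpair.2 := Primrec.snd.comp Primrec.unpair
  have hc : Computable fun m : ℕ =>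
      decide ((Denumerable.ofNat (List ℕ) m.unpair.1).length = u m.unpair.2) :=
    (Primrec.eq.comp (Primrec.list_length.comp hτ) (hu.comp hn)).decide.to_comp
  have hp : Partrec fun m : ℕ =>
      cond (decide ((Denumerable.ofNat (List ℕ) m.unpair.1).length = u m.unpair.2))
        (Part.some (g (Denumerable.ofNat (List ℕ) m.unpair.1) m.unpair.2)) Part.none :=
    Partrec.cond hc (hg.comp hτ hn).to_comp.partrec Partrec.none
  obtain ⟨c, hcode⟩ := Nat.Partrec.Code.exists_code.1 (Partrec.nat_iff.1 hp)
  refine ⟨Encodable.encode c, fun p q hq n => ?_⟩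
  obtain rfl := Part.mem_some_iff.1 hq
  have heval : ∀ k, c.eval (Nat.pair (Encodable.encode (initSeg p k)) n) =
      if k = u n then Part.some (K p n) else Part.none := by
    intro k
    rw [hcode]
    by_cases h : k = u n
    · simp [h, hK]
    · simp [h]
  have hdom : (phi (Encodable.encode c) p n).Dom := by
    rw [phi, Denumerable.ofNat_encode, oracleEval_dom]
    exact ⟨u n, by simp [heval]⟩
  obtain ⟨a, ha⟩ := Part.dom_iff_mem.1 hdom
  have ha' := ha
  rw [phi, Denumerable.ofNat_encode] at ha'
  obtain ⟨s, hs⟩ := Nat.rfindOpt_spec ha'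
  have := Nat.Partrec.Code.evaln_sound hs
  rw [heval] at this
  split_ifs at this with h
  · rwa [← Part.mem_some_iff.1 this]
  · simp at this

theorem PrefixComputable.comp {K L : Baire → Baire} (hK : PrefixComputable K)
    (hL : PrefixComputable L) : PrefixComputable fun p => K (L p) := by
  obtain ⟨u, g, hu, hum, hg, hK⟩ := hK
  obtain ⟨v, h, hv, hvm, hh, hL⟩ := hL
  refine ⟨fun n => v (u n),
    fun τ n => g ((List.range (u n)).map fun m => h (τ.take (v m)) m) n, hv.comp hu,
    hvm.comp hum, ?_, fun p n => ?_⟩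
  · refine hg.comp (Primrec.list_map (Primrec.list_range.comp (hu.comp Primrec.snd)) ?_) Primrec.snd
    exact hh.comp (Primrec.list_take.comp (hv.comp Primrec.snd)
      (Primrec.fst.comp Primrec.fst)) Primrec.snd
  · change K (L p) n = g _ n
    rw [hK]
    congr 1
    refine List.map_congr_left fun m hm => ?_
    rw [hL, take_initSeg p (hvm (List.mem_range.1 hm).le)]

theorem PrefixComputable.computable_value {K : Baire → Baire} (hK : PrefixComputable K) {p : Baire}
    (hp : Computable p) : Computable (K p) :=
  hK.isComputable.computable_value hp (Part.mem_some _)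

theorem isComputable_some : IsComputable fun p => Part.some p := by
  refine PrefixComputable.isComputable (K := fun p => p) ⟨fun n => n + 1, fun τ n => τ.getD n 0,
    Primrec.succ, fun _ _ h => Nat.succ_le_succ h, Primrec.list_getD 0, fun p n => ?_⟩
  exact (getD_initSeg (Nat.lt_succ_self n) 0).symm

theorem isComputable_pair_snd : IsComputable fun p => Part.some fun n => p (2 * n + 1) := by
  refine PrefixComputable.isComputable (K := fun p n => p (2 * n + 1))
    ⟨fun n => 2 * n + 1 + 1, fun τ n => τ.getD (2 * n + 1) 0,
    Primrec.succ.comp Primrec.nat_double_succ, fun _ _ h => by dsimp only; omega,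
    (Primrec.list_getD 0).comp Primrec.fst (Primrec.nat_double_succ.comp Primrec.snd),
    fun p n => ?_⟩
  exact (getD_initSeg (Nat.lt_succ_self _) 0).symm

/-- `K` translates names of instances of `f` to names of instances of `g` in such a way that each name
of a solution of the latter is a name of a solution of the former. -/
def Preprocesses (K : Baire → Baire) (f g : Problem) : Prop :=
  ∀ p x, f.inRep.IsName p x → x ∈ f.f.dom → ∃ x', g.inRep.IsName (K p) x' ∧ x' ∈ g.f.dom ∧
    ∀ r y, y ∈ g.f.val x' → g.outRep.IsName r y → ∃ y' ∈ f.f.val x, f.outRep.IsName r y'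

theorem Preprocesses.comp {K L : Baire → Baire} {f g h : Problem} (hK : Preprocesses K f g)
    (hL : Preprocesses L g h) : Preprocesses (fun p => L (K p)) f h := by
  intro p x hp hx
  obtain ⟨x', hx', hdom', hval'⟩ := hK p x hp hx
  obtain ⟨z, hz, hdom, hval⟩ := hL _ x' hx' hdom'
  refine ⟨z, hz, hdom, fun r y hy hr => ?_⟩
  obtain ⟨y', hy', hr'⟩ := hval r y hy hr
  exact hval' r y' hy' hr'

theorem Preprocesses.leSW_and_leW {f g : Problem} {K : Baire → Baire} (h : Preprocesses K f g)
    (hK : PrefixComputable K) : LeSW f g ∧ LeW f g := by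
  refine ⟨⟨_, _, hK.isComputable, isComputable_some, fun G hG p x hp hx => ?_⟩,
    ⟨_, _, hK.isComputable, isComputable_pair_snd, fun G hG p x hp hx => ?_⟩⟩
  all_goals
    obtain ⟨x', hx', hdom, hval⟩ := h p x hp hx
    obtain ⟨r, hr, y, hy, hry⟩ := hG _ _ hx' hdom
    refine ⟨r, ?_, hval r y hy hry⟩
  · simpa using hr
  · have : (fun n => pair p r (2 * n + 1)) = r := by
      funext n
      have h2 : (2 * n + 1) / 2 = n := by omega
      simp [pair, h2]
    simp only [Part.bind_some, Part.mem_bind_iff, Part.mem_some_iff]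
    exact ⟨r, hr, this.symm⟩

/-! ### Bounded quantifiers -/

theorem primrecPred_exists_lt {α : Type*} [Primcodable α] {f : α → ℕ} {R : α → ℕ → Prop}
    (hf : Primrec f) (hR : PrimrecRel R) : PrimrecPred fun a => ∃ m < f a, R a m :=
  ((PrimrecRel.exists_mem_list (R := fun (m : ℕ) (a : α) => R a m)
    (hR.comp Primrec.snd Primrec.fst)).comp (Primrec.list_range.comp hf) .id).of_eq
    fun a => by simp

theorem primrecPred_forall_lt {α : Type*} [Primcodable α] {f : α → ℕ} {R : α → ℕ → Prop}
    (hf : Primrec f) (hR : PrimrecRel R) : PrimrecPred fun a => ∀ m < f a, R a m :=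
  ((PrimrecRel.forall_mem_list (R := fun (m : ℕ) (a : α) => R a m)
    (hR.comp Primrec.snd Primrec.fst)).comp (Primrec.list_range.comp hf) .id).of_eq
    fun a => by simp

/-! ### Words and balls of Cantor space -/

/-- The word with a given code; numbers that do not code a word yield the empty word. -/
def boolWord (m : ℕ) : List Bool := (Encodable.decode m).getD []

/-- The word `w` for which `ball c` is `w2^ℕ`, if there is one. -/
def ballWord (c : ℕ) : Option (List Bool) := Nat.casesOn c none fun n => Encodable.decode n

/-- The point `w000…`. -/
def pad (w : List Bool) : Cantor := fun n => w.getD n false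

/-- The initial segment of length `n` of a point of Cantor space. -/
def prefixOf (x : Cantor) (n : ℕ) : List Bool := (List.range n).map x

@[simp] theorem boolWord_encode (w : List Bool) : boolWord (Encodable.encode w) = w := by
  simp [boolWord]

@[simp] theorem ballWord_zero : ballWord 0 = none := rfl

@[simp] theorem ballWord_encode_succ (w : List Bool) :
    ballWord (Encodable.encode w + 1) = some w := by
  simp [ballWord]

theorem primrec_boolWord : Primrec boolWord :=
  Primrec.option_getD.comp Primrec.decode (Primrec.const [])

theorem primrec_ballWord : Primrec ballWord :=
  Primrec.nat_casesOn₁ none Primrec.decode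

theorem mem_ball {x : Cantor} {c : ℕ} : x ∈ ball c ↔ ∃ w, ballWord c = some w ∧ x ∈ wordBall w := by
  cases c with
  | zero => simp [ball]
  | succ n => simp [ball, ballWord]

@[simp] theorem length_prefixOf (x : Cantor) (n : ℕ) : (prefixOf x n).length = n := by
  simp [prefixOf]

theorem mem_wordBall {x : Cantor} {w : List Bool} :
    x ∈ wordBall w ↔ ∀ k < w.length, x k = w.getD k false := by
  rw [wordBall, Set.mem_ofPred_eq]
  constructor
  · intro h k hk
    have : ((List.range w.length).map x).getD k false = w.getD k false := by rw [h]
    rw [← this]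
    simp [hk]
  · intro h
    refine List.ext_getElem (by simp) fun k hk hk' => ?_
    have := h k hk'
    simpa [hk'] using this

theorem mem_wordBall_iff_prefixOf {x : Cantor} {w : List Bool} :
    x ∈ wordBall w ↔ prefixOf x w.length = w := Iff.rfl

theorem self_mem_wordBall_prefixOf (x : Cantor) (n : ℕ) : x ∈ wordBall (prefixOf x n) := by
  simp [mem_wordBall_iff_prefixOf]

theorem wordBall_prefixOf (x : Cantor) (n : ℕ) : wordBall (prefixOf x n) = PiNat.cylinder x n :=
  wordBall_map x n

theorem pad_mem_wordBall (w : List Bool) : pad w ∈ wordBall w :=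
  mem_wordBall.2 fun _ _ => rfl

theorem wordBall_anti {v w : List Bool} (h : v <+: w) : wordBall w ⊆ wordBall v := by
  obtain ⟨t, rfl⟩ := h
  intro x hx
  rw [mem_wordBall] at hx ⊢
  intro k hk
  rw [hx k (by simp; omega)]
  simp [List.getElem?_append_left hk]

theorem prefix_of_mem_wordBall {v w : List Bool} {x : Cantor} (hv : x ∈ wordBall v)
    (hw : x ∈ wordBall w) (h : v.length ≤ w.length) : v <+: w := by
  rw [mem_wordBall_iff_prefixOf] at hv hw
  rw [← hv, ← hw, prefixOf, prefixOf, List.prefix_iff_eq_take, ← List.map_take, List.take_range]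
  simp [h]

theorem prefixOf_prefix_of_le (x : Cantor) {m n : ℕ} (h : m ≤ n) : prefixOf x m <+: prefixOf x n :=
  prefix_of_mem_wordBall (self_mem_wordBall_prefixOf x m) (self_mem_wordBall_prefixOf x n) (by simpa)

theorem prefixOf_mem_wordBall {x : Cantor} {w : List Bool} (h : x ∈ wordBall w) {n : ℕ}
    (hn : w.length ≤ n) : w <+: prefixOf x n :=
  prefix_of_mem_wordBall h (self_mem_wordBall_prefixOf x n) (by simpa)

theorem isOpen_wordBall (w : List Bool) : IsOpen (wordBall w) := by
  rw [← mem_wordBall_iff_prefixOf.1 (pad_mem_wordBall w), wordBall_prefixOf]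
  exact PiNat.isOpen_cylinder _ _ _

theorem isOpen_ball (c : ℕ) : IsOpen (ball c) := by
  cases c with
  | zero => exact isOpen_empty
  | succ n => exact isOpen_biUnion fun w _ => isOpen_wordBall w

theorem exists_wordBall_subset {U : Set Cantor} (hU : IsOpen U) {x : Cantor} (hx : x ∈ U) :
    ∃ n, wordBall (prefixOf x n) ⊆ U := by
  obtain ⟨_, ⟨y, n, rfl⟩, hxy, hsub⟩ :=
    (PiNat.isTopologicalBasis_cylinders (fun _ : ℕ => Bool)).exists_subset_of_mem_open hx hU
  exact ⟨n, by rwa [wordBall_prefixOf, PiNat.mem_cylinder_iff_eq.1 hxy]⟩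

theorem primrec_toNat : Primrec Bool.toNat := Primrec.dom_bool _

/-! ### Names of closed sets -/

/-- The closed set with a given negative name. -/
def negClosed (r : Baire) : TopologicalSpace.Closeds Cantor :=
  ⟨(⋃ i, ball (r i))ᶜ, (isOpen_iUnion fun i => isOpen_ball (r i)).isClosed_compl⟩

theorem isName_negClosed (r : Baire) : negRep.IsName r (negClosed r) := rfl

/-- The balls listed by `r` have a dense union. -/
def DenseName (r : Baire) : Prop := ∀ w, ∃ x ∈ wordBall w, ∃ j, x ∈ ball (r j)

theorem interior_eq_empty_iff {A : Set Cantor} :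
    interior A = ∅ ↔ ∀ w, ∃ x ∈ wordBall w, x ∉ A := by
  constructor
  · intro h w
    by_contra! hw
    have : pad w ∈ interior A := mem_interior.2 ⟨_, hw, isOpen_wordBall w, pad_mem_wordBall w⟩
    rw [h] at this
    exact this
  · intro h
    refine eq_empty_of_forall_notMem fun x hx => ?_
    obtain ⟨n, hn⟩ := exists_wordBall_subset isOpen_interior hx
    obtain ⟨y, hy, hyA⟩ := h (prefixOf x n)
    exact hyA (interior_subset (hn hy))

theorem denseName_iff {r : Baire} {A : TopologicalSpace.Closeds Cantor} (h : negRep.IsName r A) :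
    DenseName r ↔ interior (A : Set Cantor) = ∅ := by
  have h' : (A : Set Cantor) = (⋃ i, ball (r i))ᶜ := h
  rw [interior_eq_empty_iff, h']
  simp [DenseName]

theorem notMem_iff_of_isName {r : Baire} {A : TopologicalSpace.Closeds Cantor}
    (h : negRep.IsName r A) {x : Cantor} : x ∉ (A : Set Cantor) ↔ ∃ j, x ∈ ball (r j) := by
  have h' : (A : Set Cantor) = (⋃ i, ball (r i))ᶜ := h
  rw [h']
  simp

theorem tendsto_row_iff {P Q : Baire} : Tendsto (row P) atTop (𝓝 Q) ↔
    ∀ m, ∃ n₀, ∀ n ≥ n₀, P (Nat.pair n m) = Q m := by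
  rw [tendsto_pi_nhds]
  refine forall_congr' fun m => ?_
  rw [nhds_discrete, tendsto_pure, eventually_atTop]
  rfl

/-- A convergent sequence in Baire space is eventually constant on each initial segment. -/
theorem exists_forall_lt_of_tendsto {P Q : Baire} (h : Tendsto (row P) atTop (𝓝 Q)) (k : ℕ) :
    ∃ n₀, ∀ n ≥ n₀, ∀ m < k, P (Nat.pair n m) = Q m := by
  choose f hf using tendsto_row_iff.1 h
  refine ⟨(Finset.range k).sup f, fun n hn m hm => hf m n (le_trans ?_ hn)⟩
  exact Finset.le_sup (f := f) (Finset.mem_range.2 hm)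

/-! ### Finite approximations of c.e. open sets -/

/-- The initial segment of length `k` of `⟨x, q⟩`, for `x` extending `w` and `q` extending `τ`. -/
def pairWord (w : List Bool) (τ : List ℕ) (k : ℕ) : List ℕ :=
  (List.range k).map fun m => if m % 2 = 0 then (w.getD (m / 2) false).toNat else τ.getD (m / 2) 0

/-- The initial segments `w` of `x` and `τ` of `q` suffice to see in `|w|` steps that
`φ_i^{⟨x, q⟩}(0)` halts. -/
def HaltsBy (i : ℕ) (w : List Bool) (τ : List ℕ) : Prop :=
  ∃ k < w.length + 1, k ≤ τ.length ∧
    (evaln w.length (Denumerable.ofNat Code i)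
      (Nat.pair (Encodable.encode (pairWord w τ k)) 0)).isSome = true

theorem primrec_pairWord : Primrec fun a : (List Bool × List ℕ) × ℕ => pairWord a.1.1 a.1.2 a.2 := by
  refine Primrec.list_map (Primrec.list_range.comp Primrec.snd) ?_
  have h2 : Primrec fun a : ((List Bool × List ℕ) × ℕ) × ℕ => a.2 / 2 :=
    Primrec.nat_div.comp Primrec.snd (Primrec.const 2)
  refine Primrec.ite (Primrec.eq.comp (Primrec.nat_mod.comp Primrec.snd (Primrec.const 2))
    (Primrec.const 0)) (primrec_toNat.comp ((Primrec.list_getD false).comp ?_ h2))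
    ((Primrec.list_getD 0).comp ?_ h2)
  · exact Primrec.fst.comp (Primrec.fst.comp Primrec.fst)
  · exact Primrec.snd.comp (Primrec.fst.comp Primrec.fst)

theorem primrecPred_haltsBy :
    PrimrecPred fun a : ℕ × List Bool × List ℕ => HaltsBy a.1 a.2.1 a.2.2 := by
  have hw : Primrec fun a : ℕ × List Bool × List ℕ => a.2.1.length :=
    Primrec.list_length.comp (Primrec.fst.comp Primrec.snd)
  refine primrecPred_exists_lt (Primrec.succ.comp hw) (PrimrecPred.and ?_ ?_)
  · exact Primrec.nat_le.comp Primrec.snd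
      (Primrec.list_length.comp (Primrec.snd.comp (Primrec.snd.comp Primrec.fst)))
  · have hE : Primrec fun a : (ℕ × List Bool × List ℕ) × ℕ =>
        ((a.1.2.1.length, Denumerable.ofNat Code a.1.1),
          Nat.pair (Encodable.encode (pairWord a.1.2.1 a.1.2.2 a.2)) 0) :=
      ((hw.comp Primrec.fst).pair ((Primrec.ofNat Code).comp (Primrec.fst.comp Primrec.fst))).pair
        (Primrec₂.natPair.comp (Primrec.encode.comp (primrec_pairWord.comp
          ((Primrec.snd.comp Primrec.fst).pair Primrec.snd))) (Primrec.const 0))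
    exact Primrec.eq.comp (Primrec.option_isSome.comp
      (Nat.Partrec.Code.primrec_evaln.comp hE)) (Primrec.const true)

theorem pairWord_initSeg {w : List Bool} {x : Cantor} (hx : x ∈ wordBall w) (q : Baire) {N k : ℕ}
    (hw : k ≤ w.length) (hN : k ≤ N) :
    pairWord w (initSeg q N) k = initSeg (pair x.toBaire q) k := by
  refine List.map_congr_left fun m hm => ?_
  have hm' : m / 2 < k := lt_of_le_of_lt (Nat.div_le_self m 2) (List.mem_range.1 hm)
  rw [getD_initSeg (hm'.trans_le hN), ← mem_wordBall.1 hx _ (hm'.trans_le hw)]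
  rfl

theorem HaltsBy.mono {i : ℕ} {w : List Bool} {q : Baire} {N M : ℕ} (h : HaltsBy i w (initSeg q N))
    (hNM : N ≤ M) : HaltsBy i w (initSeg q M) := by
  obtain ⟨k, hk, hkN, h⟩ := h
  rw [length_initSeg] at hkN
  refine ⟨k, hk, by simpa using hkN.trans hNM, ?_⟩
  have hx := pad_mem_wordBall w
  rw [pairWord_initSeg hx q (Nat.lt_succ_iff.1 hk) hkN] at h
  rwa [pairWord_initSeg hx q (Nat.lt_succ_iff.1 hk) (hkN.trans hNM)]

theorem HaltsBy.dom {i : ℕ} {w : List Bool} {q : Baire} {N : ℕ} (h : HaltsBy i w (initSeg q N))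
    {x : Cantor} (hx : x ∈ wordBall w) : (phi i (pair x.toBaire q) 0).Dom := by
  obtain ⟨k, hk, hkN, h⟩ := h
  rw [length_initSeg] at hkN
  rw [pairWord_initSeg hx q (Nat.lt_succ_iff.1 hk) hkN] at h
  exact phi_dom_iff.2 ⟨_, _, h⟩

theorem exists_haltsBy {i : ℕ} {x : Cantor} {q : Baire} (h : (phi i (pair x.toBaire q) 0).Dom) :
    ∃ n₀, ∀ n ≥ n₀, ∀ N ≥ n₀, HaltsBy i (prefixOf x n) (initSeg q N) := by
  obtain ⟨k, t, h⟩ := phi_dom_iff.1 h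
  refine ⟨max k t, fun n hn N hN => ⟨k, ?_, ?_, ?_⟩⟩
  · simp only [length_prefixOf]; omega
  · simp only [length_initSeg]; omega
  · rw [pairWord_initSeg (self_mem_wordBall_prefixOf x n) q (by simp; omega) (by omega)]
    obtain ⟨a, ha⟩ := Option.isSome_iff_exists.1 h
    exact Option.isSome_iff_exists.2 ⟨a, Nat.Partrec.Code.evaln_mono (by simp; omega) ha⟩

/-! ### Reduction of `BCT_0` to 1-genericity -/

open Classical in
/-- The characteristic function of the graph of `p`, as a point of Cantor space. -/
noncomputable def graph (p : Baire) : Cantor := fun m => decide (p m.unpair.1 = m.unpair.2)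

theorem prefixComputable_graph : PrefixComputable fun p => (graph p).toBaire := by
  refine ⟨fun n => n + 1, fun τ n => if τ.getD n.unpair.1 0 = n.unpair.2 then 1 else 0,
    Primrec.succ, fun _ _ h => Nat.succ_le_succ h, ?_, fun p n => ?_⟩
  · have h1 : Primrec fun a : List ℕ × ℕ => a.2.unpair := Primrec.unpair.comp Primrec.snd
    exact Primrec.ite (Primrec.eq.comp ((Primrec.list_getD 0).comp Primrec.fst
      (Primrec.fst.comp h1)) (Primrec.snd.comp h1)) (Primrec.const 1) (Primrec.const 0)
  · dsimp only
    rw [getD_initSeg (Nat.lt_succ_iff.2 (Nat.unpair_left_le n))]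
    by_cases h : p n.unpair.1 = n.unpair.2 <;> simp [Cantor.toBaire, graph, h]

/-- The partially known 0-1-sequence `f` is known to begin with the word `w`. -/
def WordMatch (f : ℕ → Option ℕ) (w : List Bool) : Prop :=
  (List.range w.length).map f = w.map fun b => some b.toNat

theorem primrecPred_wordMatch {α : Type*} [Primcodable α] {f : α → ℕ → Option ℕ}
    {w : α → List Bool} (hf : Primrec₂ f) (hw : Primrec w) :
    PrimrecPred fun a => WordMatch (f a) (w a) :=
  Primrec.eq.comp
    (Primrec.list_map (Primrec.list_range.comp (Primrec.list_length.comp hw)) hf)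
    (Primrec.list_map hw (Primrec.option_some.comp (primrec_toNat.comp Primrec.snd)).to₂)

theorem wordMatch_iff {f : ℕ → Option ℕ} {w : List Bool} :
    WordMatch f w ↔ ∀ k < w.length, f k = some (w.getD k false).toNat := by
  constructor
  · intro h k hk
    have := congrArg (fun l => l[k]?) h
    simpa [hk] using this
  · intro h
    refine List.ext_getElem (by simp) fun k hk hk' => ?_
    simp only [List.length_map] at hk'
    simpa [hk'] using h k hk'

theorem toNat_injective : Function.Injective Bool.toNat := by
  intro a b
  cases a <;> cases b <;> simp

/-- The complement of a closed set with negative name `p_i` is c.e. open in the graph of `p`. -/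
theorem exists_ceOpen_graph (i : ℕ) : ∃ e, ∀ p : Baire,
    ceOpen (graph p) e = ⋃ j, ball (row p i j) := by
  -- The initial segment `τ` of `⟨x, graph p⟩` shows that `p ⟨i, j⟩ = c` and that `x` is in the `c`-th
  -- ball, where `m = ⟨⟨i, j⟩, c⟩`.
  let R : List ℕ → Prop := fun τ => ∃ m < τ.length, m.unpair.1.unpair.1 = i ∧
    τ[2 * m + 1]? = some 1 ∧ (ballWord m.unpair.2).isSome = true ∧
      WordMatch (fun b => τ[2 * b]?) ((ballWord m.unpair.2).getD [])
  have hR : PrimrecPred R := by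
    have hc : Primrec fun a : List ℕ × ℕ => ballWord a.2.unpair.2 :=
      primrec_ballWord.comp (Primrec.snd.comp (Primrec.unpair.comp Primrec.snd))
    refine primrecPred_exists_lt Primrec.list_length (PrimrecPred.and ?_ (PrimrecPred.and ?_
      (PrimrecPred.and ?_ ?_)))
    · exact Primrec.eq.comp (Primrec.fst.comp (Primrec.unpair.comp (Primrec.fst.comp
        (Primrec.unpair.comp Primrec.snd)))) (Primrec.const i)
    · exact Primrec.eq.comp (Primrec.list_getElem?.comp Primrec.fst
        (Primrec.nat_double_succ.comp Primrec.snd)) (Primrec.const (some 1))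
    · exact Primrec.eq.comp (Primrec.option_isSome.comp hc) (Primrec.const true)
    · refine primrecPred_wordMatch ?_ (Primrec.option_getD.comp hc (Primrec.const []))
      exact Primrec.list_getElem?.comp (Primrec.fst.comp Primrec.fst)
        (Primrec.nat_double.comp Primrec.snd)
  obtain ⟨e, he⟩ := exists_index hR.computablePred
  have h2 : ∀ b : ℕ, 2 * b / 2 = b := fun b => by omega
  have h21 : ∀ b : ℕ, (2 * b + 1) / 2 = b := fun b => by omega
  have hpair : ∀ (r s : Baire) (b : ℕ), pair r s (2 * b) = r b := fun r s b => by
    simp [pair]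
  have hpair' : ∀ (r s : Baire) (b : ℕ), pair r s (2 * b + 1) = s b := fun r s b => by
    simp [pair, h21]
  refine ⟨e, fun p => ?_⟩
  ext x
  change (phi e _ 0).Dom ↔ _
  rw [he, mem_iUnion]
  constructor
  · rintro ⟨k, m, -, hi, h1, hs, hw⟩
    obtain ⟨w, hw'⟩ := Option.isSome_iff_exists.1 hs
    rw [hw', Option.getD_some, wordMatch_iff] at hw
    rw [getElem?_initSeg_eq_some, hpair'] at h1
    have hm : p m.unpair.1 = m.unpair.2 := by
      by_contra hne
      simp [Cantor.toBaire, graph, hne] at h1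
    refine ⟨m.unpair.1.unpair.2, mem_ball.2 ⟨w, ?_, mem_wordBall.2 fun b hb => ?_⟩⟩
    · rw [row, ← hi, Nat.pair_unpair, hm, hw']
    · have := hw b hb
      rw [getElem?_initSeg_eq_some, hpair] at this
      exact toNat_injective this.2
  · rintro ⟨j, hj⟩
    obtain ⟨w, hw, hx⟩ := mem_ball.1 hj
    refine ⟨2 * Nat.pair (Nat.pair i j) (row p i j) + 2 + 2 * w.length,
      Nat.pair (Nat.pair i j) (row p i j), ?_, ?_, ?_, ?_, ?_⟩
    · simp only [length_initSeg]; omega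
    · simp
    · rw [getElem?_initSeg_eq_some, hpair']
      exact ⟨by omega, by simp [Cantor.toBaire, graph, row]⟩
    · simp [hw]
    · simp only [Nat.unpair_pair, hw, Option.getD_some]
      refine wordMatch_iff.2 fun b hb => ?_
      rw [getElem?_initSeg_eq_some, hpair, ← mem_wordBall.1 hx b hb]
      exact ⟨by omega, rfl⟩

/-- A 1-generic point belongs to all dense c.e. open sets. -/
theorem OneGenericIn.mem_of_dense {q x : Cantor} (h : OneGenericIn q x) {e : ℕ}
    (hd : ∀ w, ∃ y ∈ wordBall w, y ∈ ceOpen q e) : x ∈ ceOpen q e := by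
  obtain ⟨n, hn | hn⟩ := h e
  · exact hn (PiNat.self_mem_cylinder x n)
  · obtain ⟨y, hy, hye⟩ := hd (prefixOf x n)
    rw [wordBall_prefixOf] at hy
    exact absurd (show y ∈ PiNat.cylinder x n ∩ ceOpen q e from ⟨hy, hye⟩) (by simp [hn])

theorem mem_bctFun_val {A : ℕ → TopologicalSpace.Closeds Cantor} {x : Cantor} :
    x ∈ bctFun.val A ↔ ∀ i, x ∉ (A i : Set Cantor) := by
  change x ∈ (⋃ i, (A i : Set Cantor))ᶜ ↔ _
  simp

theorem preprocesses_graph : Preprocesses (fun p => (graph p).toBaire) BCT0 oneGEN := by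
  refine fun p A hp hA => ⟨graph p, rfl, mem_univ _, fun r (x : Cantor) hx hr => ⟨x, ?_, hr⟩⟩
  have hx' : OneGenericIn (graph p) x := hx
  have hp' : ∀ i, negRep.IsName (row p i) (A i) := hp
  have hA' : ∀ i, interior (A i : Set Cantor) = ∅ := hA
  refine mem_bctFun_val.2 fun i => ?_
  obtain ⟨e, he⟩ := exists_ceOpen_graph i
  have := hx'.mem_of_dense (e := e) fun w => by
    obtain ⟨y, hy, hj⟩ := (denseName_iff (hp' i)).2 (hA' i) w
    exact ⟨y, hy, by rw [he]; exact mem_iUnion.2 hj⟩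
  rw [he, mem_iUnion] at this
  exact (notMem_iff_of_isName (hp' i)).2 this

/-! ### Reduction of 1-genericity to `BCT_0'` -/

open Classical in
/-- Stage `n` of a limit-computable negative name of the boundary of `U_i^q`, from an initial
segment `τ` of `q`: the entry at position `j` is the `j`-th ball `w2^ℕ` itself, provided that it is
seen to be included in `U_i^q` or is not yet seen to meet `U_i^q`. -/
noncomputable def boundaryStage (τ : List ℕ) (n i j : ℕ) : ℕ :=
  if HaltsBy i ((ballWord j).getD []) τ ∨
    ∀ m < n, ¬ HaltsBy i ((ballWord j).getD [] ++ boolWord m) τ then j else 0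

open Classical in
/-- The limit of `boundaryStage`, for all `i` simultaneously. -/
noncomputable def boundaryName (q : Baire) : Baire := fun m =>
  if (∃ N, HaltsBy m.unpair.1 ((ballWord m.unpair.2).getD []) (initSeg q N)) ∨
    ∀ a N, ¬ HaltsBy m.unpair.1 ((ballWord m.unpair.2).getD [] ++ boolWord a) (initSeg q N)
  then m.unpair.2 else 0

open Classical in
theorem primrec_boundaryStage :
    Primrec fun a : List ℕ × ℕ × ℕ × ℕ => boundaryStage a.1 a.2.1 a.2.2.1 a.2.2.2 := by
  have hi : Primrec fun a : List ℕ × ℕ × ℕ × ℕ => a.2.2.1 :=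
    Primrec.fst.comp (Primrec.snd.comp Primrec.snd)
  have hj : Primrec fun a : List ℕ × ℕ × ℕ × ℕ => a.2.2.2 :=
    Primrec.snd.comp (Primrec.snd.comp Primrec.snd)
  have hw : Primrec fun a : List ℕ × ℕ × ℕ × ℕ => (ballWord a.2.2.2).getD [] :=
    Primrec.option_getD.comp (primrec_ballWord.comp hj) (Primrec.const [])
  refine Primrec.ite (PrimrecPred.or ?_ (primrecPred_forall_lt
    (Primrec.fst.comp Primrec.snd) (PrimrecPred.not ?_))) hj (Primrec.const 0)
  · exact primrecPred_haltsBy.comp (hi.pair (hw.pair Primrec.fst))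
  · exact primrecPred_haltsBy.comp ((hi.comp Primrec.fst).pair ((Primrec.list_append.comp
      (hw.comp Primrec.fst) (primrec_boolWord.comp Primrec.snd)).pair
        (Primrec.fst.comp Primrec.fst)))

theorem boundaryStage_eventually (q : Baire) (m : ℕ) : ∃ n₀, ∀ n ≥ n₀, ∀ N ≥ n₀,
    boundaryStage (initSeg q N) n m.unpair.1 m.unpair.2 = boundaryName q m := by
  by_cases h1 : ∃ N, HaltsBy m.unpair.1 ((ballWord m.unpair.2).getD []) (initSeg q N)
  · obtain ⟨N₀, h⟩ := h1
    refine ⟨N₀, fun n _ N hN => ?_⟩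
    rw [boundaryStage, boundaryName, if_pos (Or.inl (h.mono hN)), if_pos (Or.inl ⟨N₀, h⟩)]
  by_cases h2 : ∀ a N,
      ¬ HaltsBy m.unpair.1 ((ballWord m.unpair.2).getD [] ++ boolWord a) (initSeg q N)
  · refine ⟨0, fun n _ N _ => ?_⟩
    rw [boundaryStage, boundaryName, if_pos (Or.inr fun a _ => h2 a N), if_pos (Or.inr h2)]
  · have h3 := h2
    push Not at h2
    obtain ⟨a, N₀, h⟩ := h2
    refine ⟨max (a + 1) N₀, fun n hn N hN => ?_⟩
    rw [boundaryStage, boundaryName, if_neg (not_or.2 ⟨h1, h3⟩), if_neg]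
    rintro (h' | h')
    · exact h1 ⟨N, h'⟩
    · exact h' a (by omega) (h.mono (by omega))

theorem exists_haltsBy_extension {i : ℕ} {w : List Bool} {x : Cantor} {q : Baire}
    (hx : x ∈ wordBall w) (h : (phi i (pair x.toBaire q) 0).Dom) :
    ∃ a N, HaltsBy i (w ++ boolWord a) (initSeg q N) := by
  obtain ⟨n₀, hn⟩ := exists_haltsBy h
  obtain ⟨t, ht⟩ := prefixOf_mem_wordBall hx (le_max_left w.length n₀)
  refine ⟨Encodable.encode t, n₀, ?_⟩
  rw [boolWord_encode, ht]
  exact hn _ (le_max_right _ _) _ le_rfl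

/-- A point is in a ball of `boundaryName` if and only if it is not on the boundary of `U_i^q`. -/
theorem mem_ball_boundaryName {q : Baire} {i : ℕ} {x : Cantor} :
    (∃ j, x ∈ ball (row (boundaryName q) i j)) ↔
      ∃ n, (∀ y ∈ wordBall (prefixOf x n), (phi i (pair y.toBaire q) 0).Dom) ∨
        ∀ y ∈ wordBall (prefixOf x n), ¬ (phi i (pair y.toBaire q) 0).Dom := by
  constructor
  · rintro ⟨j, hj⟩
    rw [row, boundaryName] at hj
    simp only [Nat.unpair_pair] at hj
    split_ifs at hj with h
    · obtain ⟨w, hw, hx⟩ := mem_ball.1 hj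
      simp only [Nat.unpair_pair, hw, Option.getD_some] at h
      rw [mem_wordBall_iff_prefixOf] at hx
      refine ⟨w.length, ?_⟩
      rw [hx]
      refine h.imp ?_ ?_
      · rintro ⟨N, h⟩ y hy
        exact h.dom hy
      · intro h y hy hd
        obtain ⟨a, N, ha⟩ := exists_haltsBy_extension hy hd
        exact h a N ha
    · obtain ⟨w, hw, -⟩ := mem_ball.1 hj
      simp at hw
  · have key : ∀ v : List Bool, x ∈ wordBall v → ((∃ N, HaltsBy i v (initSeg q N)) ∨
        ∀ a N, ¬ HaltsBy i (v ++ boolWord a) (initSeg q N)) →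
        ∃ j, x ∈ ball (row (boundaryName q) i j) := by
      intro v hv h
      refine ⟨Encodable.encode v + 1, mem_ball.2 ⟨v, ?_, hv⟩⟩
      rw [row, boundaryName]
      simp only [Nat.unpair_pair]
      rw [if_pos (by simpa using h), ballWord_encode_succ]
    rintro ⟨n, h | h⟩
    · obtain ⟨n₀, hn⟩ := exists_haltsBy (h x (self_mem_wordBall_prefixOf x n))
      exact key _ (self_mem_wordBall_prefixOf x n₀) (Or.inl ⟨n₀, hn _ le_rfl _ le_rfl⟩)
    · refine key _ (self_mem_wordBall_prefixOf x n) (Or.inr fun a N ha => ?_)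
      have hp := pad_mem_wordBall (prefixOf x n ++ boolWord a)
      exact h _ (wordBall_anti (List.prefix_append _ _) hp) (ha.dom hp)

theorem denseName_boundaryName (q : Baire) (i : ℕ) : DenseName (row (boundaryName q) i) := by
  intro w
  by_cases h : ∃ y ∈ wordBall w, (phi i (pair y.toBaire q) 0).Dom
  · obtain ⟨y, hy, hd⟩ := h
    refine ⟨y, hy, mem_ball_boundaryName.2 ?_⟩
    obtain ⟨n₀, hn⟩ := exists_haltsBy hd
    exact ⟨n₀, Or.inl fun z hz => (hn n₀ le_rfl n₀ le_rfl).dom hz⟩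
  · push Not at h
    refine ⟨pad w, pad_mem_wordBall w, mem_ball_boundaryName.2 ⟨w.length, Or.inr ?_⟩⟩
    rwa [mem_wordBall_iff_prefixOf.1 (pad_mem_wordBall w)]

theorem oneGenericIn_iff_boundaryName {q x : Cantor} : OneGenericIn q x ↔
    ∀ i, ∃ j, x ∈ ball (row (boundaryName q.toBaire) i j) := by
  refine forall_congr' fun i => ?_
  rw [mem_ball_boundaryName]
  refine exists_congr fun n => or_congr ?_ ?_
  · rw [← wordBall_prefixOf]; rfl
  · rw [← wordBall_prefixOf, eq_empty_iff_forall_notMem]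
    exact ⟨fun h y hy hd => h y ⟨hy, hd⟩, fun h y hy => h y hy.1 hy.2⟩

/-- The sequence of all stages of the boundaries of the sets `U_i^q`. -/
noncomputable def boundaries (q : Baire) : Baire := fun N =>
  boundaryStage (initSeg q N) N.unpair.1 N.unpair.2.unpair.1 N.unpair.2.unpair.2

theorem prefixComputable_boundaries : PrefixComputable boundaries := by
  have h1 : Primrec fun a : List ℕ × ℕ => a.2.unpair := Primrec.unpair.comp Primrec.snd
  have h2 : Primrec fun a : List ℕ × ℕ => (a.1, a.2.unpair.1, a.2.unpair.2.unpair) :=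
    Primrec.fst.pair ((Primrec.fst.comp h1).pair (Primrec.unpair.comp (Primrec.snd.comp h1)))
  have h3 := primrec_boundaryStage.comp h2
  exact ⟨id, fun τ N => boundaryStage τ N.unpair.1 N.unpair.2.unpair.1 N.unpair.2.unpair.2,
    Primrec.id, monotone_id, h3, fun q N => rfl⟩

theorem tendsto_boundaries (q : Baire) :
    Tendsto (row (boundaries q)) atTop (𝓝 (boundaryName q)) := by
  refine tendsto_row_iff.2 fun m => ?_
  obtain ⟨n₀, h⟩ := boundaryStage_eventually q m
  refine ⟨n₀, fun n hn => ?_⟩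
  rw [boundaries]
  simp only [Nat.unpair_pair]
  exact h n hn _ (hn.trans (Nat.left_le_pair n m))

theorem preprocesses_boundaries : Preprocesses boundaries oneGEN BCT0.jump := by
  rintro p q hp -
  obtain rfl : p = Cantor.toBaire q := hp
  refine ⟨fun i => negClosed (row (boundaryName (Cantor.toBaire q)) i), ⟨_, tendsto_boundaries _,
    fun i => isName_negClosed _⟩, fun i => (denseName_iff (isName_negClosed _)).1
      (denseName_boundaryName _ i), fun r (x : Cantor) hx hr => ⟨x, ?_, hr⟩⟩
  exact oneGenericIn_iff_boundaryName.2 fun i =>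
    (notMem_iff_of_isName (isName_negClosed _)).1 (mem_bctFun_val.1 hx i)

/-! ### Equivalence of `BCT_2` and `BCT_0'` -/

/-- In the initial segment `τ` of a sequence of positive names, the `m`-th member of the `i`-th set is
seen to be a point of `w2^ℕ`. -/
def SeenIn (τ : List ℕ) (i m : ℕ) (w : List Bool) : Prop :=
  τ[Nat.pair i (Nat.pair m 0)]? = some 0 ∧
    WordMatch (fun b => τ[Nat.pair i (Nat.pair m (b + 1))]?) w

theorem primrecPred_seenIn :
    PrimrecPred fun a : (List ℕ × ℕ) × ℕ × List Bool => SeenIn a.1.1 a.1.2 a.2.1 a.2.2 := by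
  have h1 : Primrec fun a : (List ℕ × ℕ) × ℕ × List Bool => a.1.1 := Primrec.fst.comp Primrec.fst
  have h2 : Primrec fun a : (List ℕ × ℕ) × ℕ × List Bool => a.1.2 := Primrec.snd.comp Primrec.fst
  have h3 : Primrec fun a : (List ℕ × ℕ) × ℕ × List Bool => a.2.1 := Primrec.fst.comp Primrec.snd
  refine PrimrecPred.and (Primrec.eq.comp (Primrec.list_getElem?.comp h1 (Primrec₂.natPair.comp h2
    (Primrec₂.natPair.comp h3 (Primrec.const 0)))) (Primrec.const (some 0)))
    (primrecPred_wordMatch ?_ (Primrec.snd.comp Primrec.snd))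
  exact Primrec.list_getElem?.comp (h1.comp Primrec.fst) (Primrec₂.natPair.comp (h2.comp Primrec.fst)
    (Primrec₂.natPair.comp (h3.comp Primrec.fst) (Primrec.succ.comp Primrec.snd)))

theorem monotone_pair_right (a : ℕ) : Monotone (Nat.pair a) :=
  (strictMono_nat_of_lt_succ fun b => Nat.pair_lt_pair_right a (Nat.lt_succ_self b)).monotone

theorem pair_le_pair {a b c d : ℕ} (hac : a ≤ c) (hbd : b ≤ d) : Nat.pair a b ≤ Nat.pair c d :=
  ((strictMono_nat_of_lt_succ fun a => Nat.pair_lt_pair_left b (Nat.lt_succ_self a)).monotone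
    hac).trans (monotone_pair_right c hbd)

theorem seenIn_iff {p : Baire} {i m : ℕ} {x : Option Cantor} {w : List Bool}
    (hx : (optionRep cantorRep).IsName (row (row p i) m) x) :
    (∃ N, SeenIn (initSeg p N) i m w) ↔ ∃ y, x = some y ∧ y ∈ wordBall w := by
  constructor
  · rintro ⟨N, h0, hw⟩
    have h0' := (getElem?_initSeg_eq_some.1 h0).2
    cases x with
    | none => exact absurd h0' hx
    | some y =>
      refine ⟨y, rfl, mem_wordBall.2 fun b hb => toNat_injective ?_⟩
      have := (getElem?_initSeg_eq_some.1 (wordMatch_iff.1 hw b hb)).2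
      rw [← this]
      exact (congrFun hx.2 b).symm
  · rintro ⟨y, rfl, hy⟩
    obtain ⟨h0, hb⟩ := hx
    refine ⟨Nat.pair i (Nat.pair m (w.length)) + 1, ?_, wordMatch_iff.2 fun b hb' => ?_⟩
    · refine getElem?_initSeg_eq_some.2 ⟨Nat.lt_succ_iff.2 ?_, h0⟩
      exact monotone_pair_right i (monotone_pair_right m (Nat.zero_le _))
    · refine getElem?_initSeg_eq_some.2 ⟨Nat.lt_succ_iff.2 ?_, ?_⟩
      · exact monotone_pair_right i (monotone_pair_right m hb')
      · rw [← mem_wordBall.1 hy b hb']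
        exact congrFun hb b

theorem SeenIn.mono {p : Baire} {i m N M : ℕ} {w : List Bool} (h : SeenIn (initSeg p N) i m w)
    (hNM : N ≤ M) : SeenIn (initSeg p M) i m w := by
  refine ⟨?_, wordMatch_iff.2 fun b hb => ?_⟩
  · have := getElem?_initSeg_eq_some.1 h.1
    exact getElem?_initSeg_eq_some.2 ⟨this.1.trans_le hNM, this.2⟩
  · have := getElem?_initSeg_eq_some.1 (wordMatch_iff.1 h.2 b hb)
    exact getElem?_initSeg_eq_some.2 ⟨this.1.trans_le hNM, this.2⟩

open Classical in
/-- Stages of negative names of the closed sets given by the positive names in `p`: a ball is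
listed as long as no point is seen in it. -/
noncomputable def emptyBalls (p : Baire) : Baire := fun N =>
  if ∃ m < N.unpair.1, SeenIn (initSeg p N) N.unpair.2.unpair.1 m
    ((ballWord N.unpair.2.unpair.2).getD []) then 0 else N.unpair.2.unpair.2

open Classical in
theorem prefixComputable_emptyBalls : PrefixComputable emptyBalls := by
  refine ⟨id, fun τ N => if ∃ m < N.unpair.1, SeenIn τ N.unpair.2.unpair.1 m
    ((ballWord N.unpair.2.unpair.2).getD []) then 0 else N.unpair.2.unpair.2,
    Primrec.id, monotone_id, ?_, fun q N => rfl⟩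
  have h1 : Primrec fun a : List ℕ × ℕ => a.2.unpair := Primrec.unpair.comp Primrec.snd
  have h2 : Primrec fun a : List ℕ × ℕ => a.2.unpair.2.unpair :=
    Primrec.unpair.comp (Primrec.snd.comp h1)
  have hj := Primrec.snd.comp h2
  have hw : Primrec fun a : List ℕ × ℕ => (ballWord a.2.unpair.2.unpair.2).getD [] :=
    Primrec.option_getD.comp (primrec_ballWord.comp hj) (Primrec.const [])
  have h3 : Primrec fun a : (List ℕ × ℕ) × ℕ =>
      ((a.1.1, a.1.2.unpair.2.unpair.1), a.2, (ballWord a.1.2.unpair.2.unpair.2).getD []) :=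
    ((Primrec.fst.comp Primrec.fst).pair ((Primrec.fst.comp h2).comp Primrec.fst)).pair
      (Primrec.snd.pair (hw.comp Primrec.fst))
  exact Primrec.ite (primrecPred_exists_lt (Primrec.fst.comp h1) (primrecPred_seenIn.comp h3))
    (Primrec.const 0) hj

open Classical in
theorem tendsto_emptyBalls (p : Baire) : Tendsto (row (emptyBalls p)) atTop (𝓝 fun k =>
    if ∃ m N, SeenIn (initSeg p N) k.unpair.1 m ((ballWord k.unpair.2).getD [])
      then 0 else k.unpair.2) := by
  refine tendsto_row_iff.2 fun k => ?_
  by_cases h : ∃ m N, SeenIn (initSeg p N) k.unpair.1 m ((ballWord k.unpair.2).getD [])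
  · have h' := h
    obtain ⟨m, N, hm⟩ := h'
    refine ⟨max (m + 1) N, fun n hn => ?_⟩
    rw [if_pos h, emptyBalls]
    simp only [Nat.unpair_pair]
    have := Nat.left_le_pair n k
    exact if_pos ⟨m, by omega, hm.mono (by omega)⟩
  · refine ⟨0, fun n _ => ?_⟩
    rw [if_neg h, emptyBalls]
    simp only [Nat.unpair_pair]
    exact if_neg fun ⟨m, _, hm⟩ => h ⟨m, _, hm⟩

theorem preprocesses_emptyBalls : Preprocesses emptyBalls BCT2 BCT0.jump := by
  refine fun p A hp hA => ⟨A, ⟨_, tendsto_emptyBalls p, fun i => ?_⟩, hA,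
    fun r x hx hr => ⟨x, hx, hr⟩⟩
  obtain ⟨x, hx, hAx⟩ : posRep.IsName (row p i) (A i) := hp i
  change ((A i : TopologicalSpace.Closeds Cantor) : Set Cantor) = (⋃ j, ball (row _ i j))ᶜ
  rw [hAx]
  ext y
  rw [mem_compl_iff, mem_iUnion, mem_closure_iff]
  simp only [row, Nat.unpair_pair]
  constructor
  · rintro h ⟨j, hj⟩
    split_ifs at hj with hs
    · simp [ball] at hj
    · obtain ⟨w, hw, hy⟩ := mem_ball.1 hj
      obtain ⟨z, hz, m, hm⟩ := h _ (isOpen_wordBall w) hy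
      obtain ⟨N, hN⟩ := (seenIn_iff (w := w) (hx m)).2 ⟨z, hm, hz⟩
      exact hs ⟨m, N, by simpa [hw] using hN⟩
  · intro h U hU hyU
    obtain ⟨n, hn⟩ := exists_wordBall_subset hU hyU
    by_contra hne
    refine h ⟨Encodable.encode (prefixOf y n) + 1, ?_⟩
    rw [if_neg]
    · exact mem_ball.2 ⟨_, ballWord_encode_succ _, self_mem_wordBall_prefixOf y n⟩
    · rintro ⟨m, N, hN⟩
      simp only [Nat.unpair_pair, ballWord_encode_succ, Option.getD_some] at hN
      obtain ⟨z, hz, hzw⟩ := (seenIn_iff (hx m)).1 ⟨N, hN⟩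
      exact hne ⟨z, hn hzw, m, hz⟩

/-- The `c`-th ball includes `v2^ℕ`, seen from the words. -/
def CoversWord (c : ℕ) (v : List Bool) : Prop :=
  ballWord c = some (v.take ((ballWord c).getD []).length)

theorem coversWord_iff {c : ℕ} {v : List Bool} :
    CoversWord c v ↔ ∃ w, ballWord c = some w ∧ w <+: v := by
  rw [CoversWord]
  cases h : ballWord c with
  | none => simp
  | some w => simp [List.prefix_iff_eq_take]

theorem primrecPred_coversWord : PrimrecPred fun a : ℕ × List Bool => CoversWord a.1 a.2 := by
  have h : Primrec fun a : ℕ × List Bool => ballWord a.1 := primrec_ballWord.comp Primrec.fst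
  exact Primrec.eq.comp h (Primrec.option_some.comp (Primrec.list_take.comp (Primrec.list_length.comp
    (Primrec.option_getD.comp h (Primrec.const []))) Primrec.snd))

/-- For a sequence `P = ⟨P_0, P_1, …⟩` of sequences of negative names: it is not the case that `v2^ℕ`
is included, through an entry at one of the positions `j ≤ |v|`, in the `i`-th open set of all `P_n`
with `n ≥ |v|`. Failure of this property is inherited by extensions of `v`, and the words `v` for
which it fails describe the `i`-th open set of `lim P_n`. -/
def Unstable (P : Baire) (i : ℕ) (v : List Bool) : Prop :=
  ∀ j < v.length + 1, ∃ n ≥ v.length, ¬ CoversWord (P (Nat.pair n (Nat.pair i j))) v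

/-- `Unstable P i v` is seen from the initial segment `τ` of `P`. -/
def SeenUnstable (τ : List ℕ) (i : ℕ) (v : List Bool) : Prop :=
  ∀ j < v.length + 1, ∃ n < τ.length, v.length ≤ n ∧ Nat.pair n (Nat.pair i j) < τ.length ∧
    ¬ CoversWord (τ.getD (Nat.pair n (Nat.pair i j)) 0) v

theorem primrecPred_seenUnstable :
    PrimrecPred fun a : List ℕ × ℕ × List Bool => SeenUnstable a.1 a.2.1 a.2.2 := by
  have h1 : Primrec fun a : ((List ℕ × ℕ × List Bool) × ℕ) × ℕ => a.1.1.1 :=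
    Primrec.fst.comp (Primrec.fst.comp Primrec.fst)
  have hv : Primrec fun a : ((List ℕ × ℕ × List Bool) × ℕ) × ℕ => a.1.1.2.2 :=
    Primrec.snd.comp (Primrec.snd.comp (Primrec.fst.comp Primrec.fst))
  have hk : Primrec fun a : ((List ℕ × ℕ × List Bool) × ℕ) × ℕ =>
      Nat.pair a.2 (Nat.pair a.1.1.2.1 a.1.2) :=
    Primrec₂.natPair.comp Primrec.snd (Primrec₂.natPair.comp
      (Primrec.fst.comp (Primrec.snd.comp (Primrec.fst.comp Primrec.fst)))
      (Primrec.snd.comp Primrec.fst))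
  refine primrecPred_forall_lt (Primrec.succ.comp (Primrec.list_length.comp
    (Primrec.snd.comp Primrec.snd))) (primrecPred_exists_lt (Primrec.list_length.comp
      (Primrec.fst.comp Primrec.fst)) (PrimrecPred.and ?_ (PrimrecPred.and ?_ (PrimrecPred.not ?_))))
  · exact Primrec.nat_le.comp (Primrec.list_length.comp hv) Primrec.snd
  · exact Primrec.nat_lt.comp hk (Primrec.list_length.comp h1)
  · exact primrecPred_coversWord.comp (((Primrec.list_getD 0).comp h1 hk).pair hv)

theorem SeenUnstable.unstable {P : Baire} {i s : ℕ} {v : List Bool}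
    (h : SeenUnstable (initSeg P s) i v) : Unstable P i v := by
  intro j hj
  obtain ⟨n, -, hn, hk, hc⟩ := h j hj
  rw [length_initSeg] at hk
  rw [getD_initSeg hk] at hc
  exact ⟨n, hn, hc⟩

theorem Unstable.seenUnstable {P : Baire} {i : ℕ} {v : List Bool} (h : Unstable P i v) :
    ∃ s₀, ∀ s ≥ s₀, SeenUnstable (initSeg P s) i v := by
  choose! f hf hc using h
  let b : ℕ → ℕ := fun j => Nat.pair (f j) (Nat.pair i j)
  refine ⟨(Finset.range (v.length + 1)).sup b + 1, fun s hs j hj => ?_⟩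
  have hb : b j ≤ (Finset.range (v.length + 1)).sup b := Finset.le_sup (Finset.mem_range.2 hj)
  have hk : Nat.pair (f j) (Nat.pair i j) < s := by
    change b j < s
    omega
  refine ⟨f j, ?_, hf j hj, by simpa using hk, ?_⟩
  · simpa using (Nat.left_le_pair _ _).trans_lt hk
  · rw [getD_initSeg hk]
    exact hc j hj

theorem Unstable.anti {P : Baire} {i : ℕ} {v w : List Bool} (h : Unstable P i w)
    (hvw : v <+: w) : Unstable P i v := by
  have hl := hvw.length_le
  intro j hj
  obtain ⟨n, hn, hc⟩ := h j (by omega)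
  refine ⟨n, hl.trans hn, fun h' => hc ?_⟩
  obtain ⟨u, hu, huv⟩ := coversWord_iff.1 h'
  exact coversWord_iff.2 ⟨u, hu, huv.trans hvw⟩

theorem exists_not_unstable {P Q : Baire} (h : Tendsto (row P) atTop (𝓝 Q)) {i j : ℕ} {x : Cantor}
    (hx : x ∈ ball (row Q i j)) : ∃ n₀, ∀ n ≥ n₀, ¬ Unstable P i (prefixOf x n) := by
  obtain ⟨w, hw, hxw⟩ := mem_ball.1 hx
  obtain ⟨N, hN⟩ := tendsto_row_iff.1 h (Nat.pair i j)
  refine ⟨max w.length (max j N), fun n hn hu => ?_⟩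
  obtain ⟨k, hk, hc⟩ := hu j (by simp; omega)
  rw [length_prefixOf] at hk
  rw [hN k (by omega)] at hc
  exact hc (coversWord_iff.2 ⟨w, hw, prefixOf_mem_wordBall hxw (by omega)⟩)

theorem mem_ball_of_not_unstable {P Q : Baire} (h : Tendsto (row P) atTop (𝓝 Q)) {i : ℕ}
    {v : List Bool} (hv : ¬ Unstable P i v) {x : Cantor} (hx : x ∈ wordBall v) :
    ∃ j, x ∈ ball (row Q i j) := by
  unfold Unstable at hv
  push Not at hv
  obtain ⟨j, -, hj⟩ := hv
  obtain ⟨N, hN⟩ := tendsto_row_iff.1 h (Nat.pair i j)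
  have := hj (max v.length N) (le_max_left _ _)
  rw [hN _ (le_max_right _ _)] at this
  obtain ⟨w, hw, hwv⟩ := coversWord_iff.1 this
  exact ⟨j, mem_ball.2 ⟨w, hw, wordBall_anti hwv hx⟩⟩

open Classical in
/-- Positive names of the closures of the sets `{v000… | Unstable P i v}`. The `s`-th member is given by
the word `v` coded in `s`, provided that `v` is seen to be unstable at stage `s`. -/
noncomputable def unstablePoints (P : Baire) : Baire := fun N =>
  Nat.casesOn N.unpair.2.unpair.2
    (if SeenUnstable ((initSeg P N).take N.unpair.2.unpair.1) N.unpair.1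
      (boolWord N.unpair.2.unpair.1.unpair.1) then 0 else 1)
    fun b => ((boolWord N.unpair.2.unpair.1.unpair.1).getD b false).toNat

open Classical in
theorem prefixComputable_unstablePoints : PrefixComputable unstablePoints := by
  refine ⟨id, fun τ N => Nat.casesOn N.unpair.2.unpair.2
    (if SeenUnstable (τ.take N.unpair.2.unpair.1) N.unpair.1
      (boolWord N.unpair.2.unpair.1.unpair.1) then 0 else 1)
    fun b => ((boolWord N.unpair.2.unpair.1.unpair.1).getD b false).toNat,
    Primrec.id, monotone_id, ?_, fun q N => rfl⟩
  have h1 : Primrec fun a : List ℕ × ℕ => a.2.unpair := Primrec.unpair.comp Primrec.snd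
  have h2 : Primrec fun a : List ℕ × ℕ => a.2.unpair.2.unpair :=
    Primrec.unpair.comp (Primrec.snd.comp h1)
  have hv : Primrec fun a : List ℕ × ℕ => boolWord a.2.unpair.2.unpair.1.unpair.1 :=
    primrec_boolWord.comp (Primrec.fst.comp (Primrec.unpair.comp (Primrec.fst.comp h2)))
  have h3 : Primrec fun a : List ℕ × ℕ => (a.1.take a.2.unpair.2.unpair.1, a.2.unpair.1,
      boolWord a.2.unpair.2.unpair.1.unpair.1) :=
    (Primrec.list_take.comp (Primrec.fst.comp h2) Primrec.fst).pair ((Primrec.fst.comp h1).pair hv)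
  have h4 : Primrec fun a : List ℕ × ℕ => if SeenUnstable (a.1.take a.2.unpair.2.unpair.1)
      a.2.unpair.1 (boolWord a.2.unpair.2.unpair.1.unpair.1) then 0 else 1 :=
    Primrec.ite (primrecPred_seenUnstable.comp h3) (Primrec.const 0) (Primrec.const 1)
  have h5 : Primrec₂ fun (a : List ℕ × ℕ) (b : ℕ) =>
      ((boolWord a.2.unpair.2.unpair.1.unpair.1).getD b false).toNat :=
    primrec_toNat.comp ((Primrec.list_getD false).comp (hv.comp Primrec.fst) Primrec.snd)
  exact Primrec.nat_casesOn (Primrec.snd.comp h2) h4 h5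

theorem isName_unstablePoints (P : Baire) (i : ℕ) (A : TopologicalSpace.Closeds Cantor)
    (hA : (A : Set Cantor) = closure {y | ∃ v, Unstable P i v ∧ y = pad v}) :
    posRep.IsName (row (unstablePoints P) i) A := by
  classical
  refine ⟨fun s => if SeenUnstable (initSeg P s) i (boolWord s.unpair.1) then
    some (pad (boolWord s.unpair.1)) else none, fun s => ?_, ?_⟩
  · have ht : (initSeg P (Nat.pair i (Nat.pair s 0))).take s = initSeg P s :=
      take_initSeg P ((Nat.left_le_pair s 0).trans (Nat.right_le_pair i _))
    dsimp only
    split_ifs with h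
    · refine ⟨?_, ?_⟩
      · simp only [row, unstablePoints, Nat.unpair_pair, ht]
        exact if_pos h
      · funext b
        simp only [row, unstablePoints, Nat.unpair_pair]
        rfl
    · change row (row (unstablePoints P) i) s 0 ≠ 0
      simp only [row, unstablePoints, Nat.unpair_pair, ht]
      rw [if_neg h]
      exact one_ne_zero
  · rw [hA]
    congr 1
    ext y
    constructor
    · rintro ⟨v, hv, rfl⟩
      obtain ⟨s₀, hs⟩ := hv.seenUnstable
      refine ⟨Nat.pair (Encodable.encode v) s₀, ?_⟩
      simp only [Nat.unpair_pair, boolWord_encode]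
      rw [if_pos (hs _ (Nat.right_le_pair _ _))]
    · rintro ⟨s, hs⟩
      dsimp only at hs
      split_ifs at hs with h
      exact ⟨_, h.unstable, (Option.some.inj hs).symm⟩

theorem preprocesses_unstablePoints : Preprocesses unstablePoints BCT0.jump BCT2 := by
  refine fun P A hP hA => ⟨fun i => ⟨closure {y | ∃ v, Unstable P i v ∧ y = pad v}, isClosed_closure⟩,
      fun i => isName_unstablePoints P i _ rfl, fun i => ?_,
      fun r (x : Cantor) hx hr => ⟨x, ?_, hr⟩⟩
  · obtain ⟨Q, hQ, hQA⟩ := hP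
    have hd := (denseName_iff (hQA i)).2 (hA i)
    refine interior_eq_empty_iff.2 fun w => ?_
    obtain ⟨y, hy, j, hj⟩ := hd w
    obtain ⟨n₀, hn⟩ := exists_not_unstable hQ hj
    -- `v` is a stable extension of `w`; the only limit point of unstable words in `v2^ℕ` is `v000…`.
    obtain ⟨v, hwv, hv⟩ : ∃ v, w <+: v ∧ ¬ Unstable P i v :=
      ⟨_, prefixOf_mem_wordBall hy (le_max_left _ n₀), hn _ (le_max_right _ _)⟩
    refine ⟨pad (v ++ [true]), wordBall_anti (hwv.trans (List.prefix_append _ _))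
      (pad_mem_wordBall _), fun hc => ?_⟩
    obtain ⟨z, hz, u, hu, rfl⟩ :=
      mem_closure_iff.1 hc _ (isOpen_wordBall (v ++ [true])) (pad_mem_wordBall _)
    rcases le_or_gt v.length u.length with hl | hl
    · exact hv (hu.anti (prefix_of_mem_wordBall
        (wordBall_anti (List.prefix_append _ _) hz) (pad_mem_wordBall u) hl))
    · have := mem_wordBall.1 hz v.length (by simp)
      simp [pad, List.getElem?_eq_none hl.le] at this
  · obtain ⟨Q, hQ, hQA⟩ := hP
    refine mem_bctFun_val.2 fun i => (notMem_iff_of_isName (hQA i)).2 ?_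
    have hxi : x ∉ closure {y | ∃ v, Unstable P i v ∧ y = pad v} := mem_bctFun_val.1 hx i
    by_contra hne
    refine hxi (mem_closure_iff.2 fun U hU hxU => ?_)
    obtain ⟨n, hn⟩ := exists_wordBall_subset hU hxU
    refine ⟨pad (prefixOf x n), hn (pad_mem_wordBall _), prefixOf x n, ?_, rfl⟩
    by_contra hs
    exact hne (mem_ball_of_not_unstable hQ hs (self_mem_wordBall_prefixOf x n))

/-! ### The greedy construction for the Baire category theorem -/

/-- A proper extension of `w` that describes a subset of the `c`-th ball, if `w2^ℕ` meets that ball. The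
last bit makes sure that the extension is proper. -/
def extendInto (w : List Bool) (c : ℕ) : Option (List Bool) :=
  (ballWord c).bind fun v =>
    if v = w.take v.length then some (w ++ [false])
    else if w = v.take w.length then some (v ++ [false]) else none

theorem primrec_extendInto : Primrec₂ extendInto := by
  have hw : Primrec fun a : (List Bool × ℕ) × List Bool => a.1.1 := Primrec.fst.comp Primrec.fst
  have hv : Primrec fun a : (List Bool × ℕ) × List Bool => a.2 := Primrec.snd
  refine Primrec.option_bind (primrec_ballWord.comp Primrec.snd) ?_
  refine Primrec.ite (Primrec.eq.comp hv (Primrec.list_take.comp (Primrec.list_length.comp hv) hw))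
    (Primrec.option_some.comp (Primrec.list_concat.comp hw (Primrec.const false)))
    (Primrec.ite (Primrec.eq.comp hw (Primrec.list_take.comp (Primrec.list_length.comp hw) hv))
      (Primrec.option_some.comp (Primrec.list_concat.comp hv (Primrec.const false)))
      (Primrec.const none))

theorem extendInto_eq_some {w v : List Bool} {c : ℕ} (h : extendInto w c = some v) :
    w <+: v ∧ w.length < v.length ∧ wordBall v ⊆ ball c := by
  obtain ⟨u, hu, h⟩ := Option.bind_eq_some_iff.1 h
  have hball : wordBall u ⊆ ball c := fun x hx => mem_ball.2 ⟨u, hu, hx⟩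
  split_ifs at h with h1 h2
  · obtain rfl := Option.some.inj h
    exact ⟨List.prefix_append _ _, by simp, (wordBall_anti
      ((List.prefix_iff_eq_take.2 h1).trans (List.prefix_append _ _))).trans hball⟩
  · obtain rfl := Option.some.inj h
    have h2' := List.prefix_iff_eq_take.2 h2
    have := h2'.length_le
    exact ⟨h2'.trans (List.prefix_append _ _), by simp; omega,
      (wordBall_anti (List.prefix_append _ _)).trans hball⟩

theorem exists_extendInto {w : List Bool} {x : Cantor} {c : ℕ} (hx : x ∈ wordBall w)
    (hc : x ∈ ball c) : ∃ v, extendInto w c = some v := by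
  obtain ⟨u, hu, hxu⟩ := mem_ball.1 hc
  rcases le_total u.length w.length with h | h
  · exact ⟨w ++ [false], by
      simp [extendInto, hu, ← List.prefix_iff_eq_take, prefix_of_mem_wordBall hxu hx h]⟩
  · have h' := prefix_of_mem_wordBall hx hxu h
    simp only [extendInto, hu, ← List.prefix_iff_eq_take, Option.bind_some, h', if_true]
    split_ifs
    · exact ⟨_, rfl⟩
    · exact ⟨_, rfl⟩

/-- `W` is the sequence of words of the greedy construction for the negative names in `Q`: the word
`W (i + 1)` results from `W i` through the first ball listed in the `i`-th name that meets
`(W i)2^ℕ`. -/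
def IsGreedy (Q : Baire) (W : ℕ → List Bool) : Prop :=
  W 0 = [] ∧ ∀ i, ∃ j, extendInto (W i) (row Q i j) = some (W (i + 1)) ∧
    ∀ k < j, extendInto (W i) (row Q i k) = none

theorem exists_isGreedy {Q : Baire} (hQ : ∀ i, DenseName (row Q i)) : ∃ W, IsGreedy Q W := by
  classical
  have key : ∀ i w, ∃ v, ∃ j, extendInto w (row Q i j) = some v ∧
      ∀ k < j, extendInto w (row Q i k) = none := by
    intro i w
    obtain ⟨x, hx, j, hj⟩ := hQ i w
    have hex : ∃ j, (extendInto w (row Q i j)).isSome = true := by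
      obtain ⟨v, hv⟩ := exists_extendInto hx hj
      exact ⟨j, by simp [hv]⟩
    obtain ⟨v, hv⟩ := Option.isSome_iff_exists.1 (Nat.find_spec hex)
    refine ⟨v, Nat.find hex, hv, fun k hk => ?_⟩
    simpa using Nat.find_min hex hk
  choose f hf using key
  exact ⟨fun i => Nat.rec [] (fun i w => f i w) i, rfl, fun i => hf i _⟩

/-- The point determined by the words of a greedy construction. -/
def greedyPoint (W : ℕ → List Bool) : Cantor := fun k => (W (k + 1)).getD k false

namespace IsGreedy

variable {Q : Baire} {W : ℕ → List Bool}

theorem prefix_of_le (h : IsGreedy Q W) {i j : ℕ} (hij : i ≤ j) : W i <+: W j := by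
  induction j, hij using Nat.le_induction with
  | base => exact List.prefix_rfl
  | succ j _ ih =>
    obtain ⟨k, hk, -⟩ := h.2 j
    exact ih.trans (extendInto_eq_some hk).1

theorem le_length (h : IsGreedy Q W) (i : ℕ) : i ≤ (W i).length := by
  induction i with
  | zero => exact Nat.zero_le _
  | succ i ih =>
    obtain ⟨k, hk, -⟩ := h.2 i
    have := (extendInto_eq_some hk).2.1
    omega

theorem greedyPoint_mem (h : IsGreedy Q W) (i : ℕ) : greedyPoint W ∈ wordBall (W i) := by
  refine mem_wordBall.2 fun k hk => ?_
  have hk' : k < (W (k + 1)).length := h.le_length (k + 1)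
  have h1 := mem_wordBall.1 (wordBall_anti (h.prefix_of_le (le_max_left i (k + 1)))
    (pad_mem_wordBall _)) k hk
  have h2 := mem_wordBall.1 (wordBall_anti (h.prefix_of_le (le_max_right i (k + 1)))
    (pad_mem_wordBall _)) k hk'
  exact h2.symm.trans h1

theorem exists_mem_ball (h : IsGreedy Q W) (i : ℕ) : ∃ j, greedyPoint W ∈ ball (row Q i j) := by
  obtain ⟨j, hj, -⟩ := h.2 i
  exact ⟨j, (extendInto_eq_some hj).2.2 (h.greedyPoint_mem (i + 1))⟩

/-- A greedy construction on a computable name is computable. -/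
theorem computable (h : IsGreedy Q W) (hQ : Computable Q) : Computable W := by
  have hS : Computable₂ fun (a : ℕ × List Bool) (j : ℕ) => extendInto a.2 (row Q a.1 j) :=
    primrec_extendInto.to_comp.comp (Computable.snd.comp Computable.fst) (hQ.comp
      (Primrec₂.natPair.to_comp.comp (Computable.fst.comp Computable.fst) Computable.snd))
  have hP : Partrec fun i : ℕ => Nat.rec (motive := fun _ => Part (List Bool)) (Part.some [])
      (fun i IH => IH.bind fun w => Nat.rfindOpt fun j => extendInto w (row Q i j)) i :=
    Partrec.nat_rec (f := fun i : ℕ => i) (g := fun _ => Part.some [])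
      (h := fun _ a => Nat.rfindOpt fun j => extendInto a.2 (row Q a.1 j)) Computable.id
      (Computable.const []).partrec ((Partrec.rfindOpt hS).comp Computable.snd).to₂
  refine Partrec.of_eq_tot hP fun i => ?_
  induction i with
  | zero => rw [h.1]; exact Part.mem_some _
  | succ i ih =>
    obtain ⟨j, hj, hk⟩ := h.2 i
    exact Part.mem_bind_iff.2 ⟨_, ih, mem_rfindOpt.2 ⟨j, hj, hk⟩⟩

theorem computable_greedyPoint (h : IsGreedy Q W) (hQ : Computable Q) :
    Computable (greedyPoint W) :=
  (Primrec.list_getD false).to_comp.comp ((h.computable hQ).comp Computable.succ) Computable.id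

end IsGreedy

/-- The first extension of `w` provided by the `i`-th name in `Q`, with search bound `n`. -/
def boundedExtend (Q : Baire) (n i : ℕ) (w : List Bool) : Option (List Bool) :=
  ((List.range n).filterMap fun j => extendInto w (row Q i j)).head?

/-- The words of the greedy construction with search bound `n`, in which unsuccessful steps are
skipped. -/
def boundedGreedy (Q : Baire) (n : ℕ) : ℕ → List Bool
  | 0 => []
  | i + 1 => (boundedExtend Q n i (boundedGreedy Q n i)).getD (boundedGreedy Q n i)

theorem boundedExtend_eq {Q : Baire} {i j : ℕ} {w v : List Bool}
    (hj : extendInto w (row Q i j) = some v) (hk : ∀ k < j, extendInto w (row Q i k) = none) {n : ℕ}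
    (hn : j < n) : boundedExtend Q n i w = some v := by
  obtain ⟨m, rfl⟩ := Nat.exists_eq_add_of_lt hn
  have h1 : (List.range j).filterMap (fun j => extendInto w (row Q i j)) = [] := by
    rw [List.filterMap_eq_nil_iff]
    exact fun k hk' => hk k (List.mem_range.1 hk')
  rw [boundedExtend, show j + m + 1 = j + (m + 1) by ring, List.range_add, List.filterMap_append, h1,
    List.nil_append, List.range_succ_eq_map, List.map_cons, add_zero, List.filterMap_cons_some (f := fun j => extendInto w (row Q i j)) (b := v) hj]
  rfl

theorem boundedGreedy_prefix_of_le (Q : Baire) (n : ℕ) {i j : ℕ} (h : i ≤ j) :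
    boundedGreedy Q n i <+: boundedGreedy Q n j := by
  induction j, h using Nat.le_induction with
  | base => exact List.prefix_rfl
  | succ j _ ih =>
    refine ih.trans ?_
    rw [boundedGreedy]
    cases h : boundedExtend Q n j (boundedGreedy Q n j) with
    | none => exact List.prefix_rfl
    | some v =>
      have := List.mem_of_head? h
      obtain ⟨k, -, hk⟩ := List.mem_filterMap.1 this
      exact (extendInto_eq_some hk).1

/-- Each word of a greedy construction is found by the bounded constructions from some stage on, even
if only a sufficiently long initial segment of the name is correct. -/
theorem IsGreedy.boundedGreedy_eventually {Q : Baire} {W : ℕ → List Bool} (h : IsGreedy Q W)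
    (i : ℕ) : ∃ n₀, ∀ n ≥ n₀, ∀ Q' : Baire, (∀ m < n₀, Q' m = Q m) →
      boundedGreedy Q' n i = W i := by
  induction i with
  | zero => exact ⟨0, fun n _ Q' _ => h.1.symm⟩
  | succ i ih =>
    obtain ⟨n₁, h₁⟩ := ih
    obtain ⟨j, hj, hk⟩ := h.2 i
    refine ⟨max n₁ (Nat.pair i j + 1), fun n hn Q' hQ' => ?_⟩
    have hrow : ∀ k ≤ j, row Q' i k = row Q i k := fun k hk =>
      hQ' _ (lt_max_of_lt_right (Nat.lt_succ_iff.2 (monotone_pair_right i hk)))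
    have hjn : j < n := by
      have := Nat.right_le_pair i j
      omega
    rw [boundedGreedy, h₁ n (by omega) Q' fun m hm => hQ' m (lt_max_of_lt_left hm),
      boundedExtend_eq (by rw [hrow j le_rfl, hj]) (fun k hkj => by rw [hrow k hkj.le, hk k hkj]) hjn,
      Option.getD_some]

/-- The bounded construction depends on finitely many entries of the names. -/
theorem boundedGreedy_congr {Q Q' : Baire} {n : ℕ} {i : ℕ}
    (h : ∀ k < i, ∀ j < n, row Q k j = row Q' k j) : boundedGreedy Q n i = boundedGreedy Q' n i := by
  induction i with
  | zero => rfl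
  | succ i ih =>
    have h1 : boundedExtend Q n i = boundedExtend Q' n i := by
      funext w
      rw [boundedExtend, boundedExtend]
      congr 1
      refine List.filterMap_congr fun j hj => ?_
      rw [h i (Nat.lt_succ_self i) j (List.mem_range.1 hj)]
    rw [boundedGreedy, boundedGreedy, ih fun k hk => h k (hk.trans (Nat.lt_succ_self i)), h1]

/-- The approximations of the greedy construction from the rows of `P`. -/
def greedyStages (P : Baire) : Baire := fun N =>
  ((boundedGreedy (row P N.unpair.1) N.unpair.1 N.unpair.1).getD N.unpair.2 false).toNat

theorem primrec_boundedGreedy : Primrec fun a : List ℕ × ℕ =>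
    boundedGreedy (fun m => a.1.getD (Nat.pair a.2 m) 0) a.2 a.2 := by
  have hr : Primrec fun b : ((List ℕ × ℕ) × ℕ × List Bool) × ℕ =>
      b.1.1.1.getD (Nat.pair b.1.1.2 (Nat.pair b.1.2.1 b.2)) 0 :=
    (Primrec.list_getD 0).comp (Primrec.fst.comp (Primrec.fst.comp Primrec.fst))
      (Primrec₂.natPair.comp (Primrec.snd.comp (Primrec.fst.comp Primrec.fst))
        (Primrec₂.natPair.comp (Primrec.fst.comp (Primrec.snd.comp Primrec.fst)) Primrec.snd))
  have he : Primrec₂ fun (b : (List ℕ × ℕ) × ℕ × List Bool) (j : ℕ) =>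
      extendInto b.2.2 (b.1.1.getD (Nat.pair b.1.2 (Nat.pair b.2.1 j)) 0) :=
    primrec_extendInto.comp (Primrec.snd.comp (Primrec.snd.comp Primrec.fst)) hr
  have hs : Primrec₂ fun (a : List ℕ × ℕ) (b : ℕ × List Bool) =>
      (((List.range a.2).filterMap fun j =>
        extendInto b.2 (a.1.getD (Nat.pair a.2 (Nat.pair b.1 j)) 0)).head?).getD b.2 :=
    Primrec.option_getD.comp (Primrec.list_head?.comp (Primrec.listFilterMap
      (Primrec.list_range.comp (Primrec.snd.comp Primrec.fst)) he)) (Primrec.snd.comp Primrec.snd)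
  refine (Primrec.nat_rec' (f := fun a : List ℕ × ℕ => a.2) (g := fun _ => ([] : List Bool))
    Primrec.snd (Primrec.const []) hs).of_eq fun a => ?_
  have : ∀ i, Nat.rec (motive := fun _ => List Bool) [] (fun i w =>
      (((List.range a.2).filterMap fun j =>
        extendInto w (a.1.getD (Nat.pair a.2 (Nat.pair i j)) 0)).head?).getD w) i =
      boundedGreedy (fun m => a.1.getD (Nat.pair a.2 m) 0) a.2 i := by
    intro i
    induction i with
    | zero => rfl
    | succ i ih =>
      rw [boundedGreedy, ← ih]
      rfl
  exact this a.2

theorem prefixComputable_greedyStages : PrefixComputable greedyStages := by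
  have h1 : Primrec fun a : List ℕ × ℕ => a.2.unpair := Primrec.unpair.comp Primrec.snd
  have h2 : Primrec fun a : List ℕ × ℕ => (a.1, a.2.unpair.1) :=
    Primrec.fst.pair (Primrec.fst.comp h1)
  have h3 := primrec_toNat.comp ((Primrec.list_getD false).comp (primrec_boundedGreedy.comp h2)
    (Primrec.snd.comp h1))
  have hmono : ∀ {a b c a' b' c' : ℕ}, a ≤ a' → b ≤ b' → c ≤ c' →
      Nat.pair a (Nat.pair b c) ≤ Nat.pair a' (Nat.pair b' c') := fun ha hb hc =>
    pair_le_pair ha (pair_le_pair hb hc)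
  refine ⟨fun N => Nat.pair N (Nat.pair N N) + 1, fun τ N =>
    ((boundedGreedy (fun m => τ.getD (Nat.pair N.unpair.1 m) 0) N.unpair.1 N.unpair.1).getD
      N.unpair.2 false).toNat, ?_, fun M N h => Nat.succ_le_succ (hmono h h h), h3, fun P N => ?_⟩
  · exact Primrec.succ.comp (Primrec₂.natPair.comp Primrec.id
      (Primrec₂.natPair.comp Primrec.id Primrec.id))
  · rw [greedyStages]
    congr 2
    refine boundedGreedy_congr fun i hi j hj => ?_
    have hN := Nat.unpair_left_le N
    rw [row, row, row, getD_initSeg]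
    exact Nat.lt_succ_iff.2 (hmono hN (by omega) (by omega))

theorem IsGreedy.tendsto_greedyStages {P Q : Baire} {W : ℕ → List Bool} (h : IsGreedy Q W)
    (hP : Tendsto (row P) atTop (𝓝 Q)) :
    Tendsto (row (greedyStages P)) atTop (𝓝 (greedyPoint W).toBaire) := by
  refine tendsto_row_iff.2 fun k => ?_
  obtain ⟨n₁, h₁⟩ := h.boundedGreedy_eventually (k + 1)
  obtain ⟨n₂, h₂⟩ := exists_forall_lt_of_tendsto hP n₁
  refine ⟨max n₁ (max n₂ (k + 1)), fun n hn => ?_⟩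
  have hW := h₁ n (by omega) (row P n) fun m hm => h₂ n (by omega) m hm
  have hpre := boundedGreedy_prefix_of_le (row P n) n (show k + 1 ≤ n by omega)
  rw [hW] at hpre
  have := mem_wordBall.1 (wordBall_anti hpre (pad_mem_wordBall _)) k (h.le_length (k + 1))
  rw [greedyStages]
  simp only [Nat.unpair_pair]
  exact congrArg Bool.toNat this

/-! ### Reduction of `BCT_0'` to `lim_J` -/

theorem PrefixComputable.primrec_zero {K : Baire → Baire} (hK : PrefixComputable K) :
    Primrec (K fun _ => 0) := by
  obtain ⟨u, g, hu, -, hg, hK⟩ := hK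
  refine (hg.comp (Primrec.list_map (Primrec.list_range.comp hu)
    (Primrec.const 0).to₂) Primrec.id).of_eq fun n => ?_
  rw [hK]
  rfl

/-- Interleaves the components of two sequences of sequences. -/
def interleave (P R : Baire) : Baire := fun m =>
  if m.unpair.1 % 2 = 0 then P (Nat.pair (m.unpair.1 / 2) m.unpair.2)
  else R (Nat.pair (m.unpair.1 / 2) m.unpair.2)

theorem row_interleave_even (P R : Baire) (i : ℕ) : row (interleave P R) (2 * i) = row P i := by
  funext j
  simp [row, interleave]

theorem row_interleave_odd (P R : Baire) (i : ℕ) : row (interleave P R) (2 * i + 1) = row R i := by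
  funext j
  have : (2 * i + 1) / 2 = i := by omega
  simp [row, interleave, this]

/-- `P` interleaved, stage by stage, with the names of the boundaries of the c.e. open sets. -/
noncomputable def addBoundaries (P : Baire) : Baire := fun N =>
  interleave (row P N.unpair.1) (row (boundaries fun _ => 0) N.unpair.1) N.unpair.2

theorem prefixComputable_addBoundaries : PrefixComputable addBoundaries := by
  have h1 : Primrec fun a : List ℕ × ℕ => a.2.unpair := Primrec.unpair.comp Primrec.snd
  have h2 : Primrec fun a : List ℕ × ℕ => a.2.unpair.2.unpair :=
    Primrec.unpair.comp (Primrec.snd.comp h1)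
  have hk : Primrec fun a : List ℕ × ℕ => Nat.pair a.2.unpair.1
      (Nat.pair (a.2.unpair.2.unpair.1 / 2) a.2.unpair.2.unpair.2) :=
    Primrec₂.natPair.comp (Primrec.fst.comp h1) (Primrec₂.natPair.comp
      (Primrec.nat_div.comp (Primrec.fst.comp h2) (Primrec.const 2)) (Primrec.snd.comp h2))
  have h3 := Primrec.ite (Primrec.eq.comp (Primrec.nat_mod.comp (Primrec.fst.comp h2)
      (Primrec.const 2)) (Primrec.const 0)) ((Primrec.list_getD 0).comp Primrec.fst hk)
    (prefixComputable_boundaries.primrec_zero.comp hk)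
  refine ⟨fun N => N + 1, _, Primrec.succ, fun _ _ h => Nat.succ_le_succ h, h3.to₂, fun P N => ?_⟩
  have hN : Nat.pair N.unpair.1 (Nat.pair (N.unpair.2.unpair.1 / 2) N.unpair.2.unpair.2) ≤ N := by
    conv_rhs => rw [← Nat.pair_unpair N, ← Nat.pair_unpair N.unpair.2]
    exact pair_le_pair le_rfl (pair_le_pair (Nat.div_le_self _ _) le_rfl)
  dsimp only
  rw [getD_initSeg (Nat.lt_succ_iff.2 hN)]
  rfl

theorem tendsto_addBoundaries {P Q : Baire} (h : Tendsto (row P) atTop (𝓝 Q)) :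
    Tendsto (row (addBoundaries P)) atTop
      (𝓝 (interleave Q (boundaryName fun _ => 0))) := by
  refine tendsto_row_iff.2 fun m => ?_
  obtain ⟨n₁, h₁⟩ := tendsto_row_iff.1 h (Nat.pair (m.unpair.1 / 2) m.unpair.2)
  obtain ⟨n₂, h₂⟩ := tendsto_row_iff.1 (tendsto_boundaries fun _ => 0)
    (Nat.pair (m.unpair.1 / 2) m.unpair.2)
  refine ⟨max n₁ n₂, fun n hn => ?_⟩
  simp only [addBoundaries, interleave, row, Nat.unpair_pair]
  rw [h₁ n (by omega), h₂ n (by omega)]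

theorem denseName_interleave {P R : Baire} (hP : ∀ i, DenseName (row P i))
    (hR : ∀ i, DenseName (row R i)) (i : ℕ) : DenseName (row (interleave P R) i) := by
  rcases Nat.even_or_odd' i with ⟨k, rfl | rfl⟩
  · rw [row_interleave_even]; exact hP k
  · rw [row_interleave_odd]; exact hR k

/-- The zero sequence as a point of Cantor space. -/
def zeroPoint : Cantor := fun _ => false

/-- Computations with the oracle `p` can be simulated with an oracle `⟨p, q⟩`. -/
theorem exists_index_left (i : ℕ) :
    ∃ e, ∀ p q : Baire, (phi e (pair p q) 0).Dom ↔ (phi i p 0).Dom := by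
  let c := Denumerable.ofNat Code i
  let R : List ℕ → Prop := fun τ => ∃ k < τ.length + 1, 2 * k ≤ τ.length ∧
    (evaln τ.length c (Nat.pair (Encodable.encode ((List.range k).map fun b => τ.getD (2 * b) 0))
      0)).isSome = true
  have hR : PrimrecPred R := by
    have hl : Primrec fun a : List ℕ × ℕ => a.1.length := Primrec.list_length.comp Primrec.fst
    refine primrecPred_exists_lt (Primrec.succ.comp Primrec.list_length) (PrimrecPred.and
      (Primrec.nat_le.comp (Primrec.nat_double.comp Primrec.snd) hl) ?_)
    have hA : Primrec fun a : List ℕ × ℕ => ((a.1.length, c),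
        Nat.pair (Encodable.encode ((List.range a.2).map fun b => a.1.getD (2 * b) 0)) 0) :=
      (hl.pair (Primrec.const c)).pair (Primrec₂.natPair.comp (Primrec.encode.comp
        (Primrec.list_map (Primrec.list_range.comp Primrec.snd) ((Primrec.list_getD 0).comp
          (Primrec.fst.comp Primrec.fst) (Primrec.nat_double.comp Primrec.snd)).to₂))
            (Primrec.const 0))
    have hE := Nat.Partrec.Code.primrec_evaln.comp hA
    exact Primrec.eq.comp (Primrec.option_isSome.comp hE) (Primrec.const true)
  obtain ⟨e, he⟩ := exists_index hR.computablePred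
  refine ⟨e, fun p q => ?_⟩
  have hL : ∀ k l, 2 * k ≤ l →
      ((List.range k).map fun b => (initSeg (pair p q) l).getD (2 * b) 0) = initSeg p k := by
    intro k l hl
    refine List.map_congr_left fun b hb => ?_
    rw [getD_initSeg (by have := List.mem_range.1 hb; omega)]
    simp [pair]
  rw [he, phi_dom_iff]
  constructor
  · rintro ⟨l, k, -, hk, h⟩
    rw [length_initSeg] at hk h
    rw [hL k l hk] at h
    exact ⟨k, l, h⟩
  · rintro ⟨k, t, h⟩
    refine ⟨max (2 * k) t, k, ?_, ?_, ?_⟩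
    · rw [length_initSeg]; omega
    · rw [length_initSeg]; omega
    · rw [length_initSeg, hL k _ (le_max_left _ _)]
      obtain ⟨a, ha⟩ := Option.isSome_iff_exists.1 h
      exact Option.isSome_iff_exists.2
        ⟨a, Nat.Partrec.Code.evaln_mono (le_max_right _ _) ha⟩

/-- A sequence that converges to a 1-generic point also converges in the jump topology. -/
theorem OneGenericIn.tendsto_jump {q x : Cantor} (hx : OneGenericIn q x) {u : ℕ → Cantor}
    (hu : Tendsto (fun n => (u n).toBaire) atTop (𝓝 x.toBaire)) :
    Tendsto (fun n => (u n).toBaire) atTop (@nhds Baire jumpTopology x.toBaire) := by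
  rw [jumpTopology, nhds_induced, tendsto_comap_iff, tendsto_pi_nhds]
  intro i
  rw [nhds_discrete, tendsto_pure]
  obtain ⟨e, he'⟩ := exists_index_left i
  have he : ∀ y q : Cantor, y ∈ ceOpen q e ↔ (phi i y.toBaire 0).Dom := fun y q => he' _ _
  obtain ⟨n, hn⟩ := hx e
  have hev : ∀ᶠ m in atTop, u m ∈ PiNat.cylinder x n := by
    rw [tendsto_pi_nhds] at hu
    simp only [nhds_discrete, tendsto_pure] at hu
    have := (eventually_all_finset (Finset.range n)).2 fun k _ => hu k
    filter_upwards [this] with m hm k hk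
    exact toNat_injective (hm k (Finset.mem_range.2 hk))
  filter_upwards [hev] with m hm
  have hself := PiNat.self_mem_cylinder x n
  suffices h : (phi i (u m).toBaire 0).Dom ↔ (phi i x.toBaire 0).Dom by
    rw [Function.comp_apply, turingJump, turingJump]
    by_cases hd : (phi i x.toBaire 0).Dom
    · rw [if_pos hd, if_pos (h.2 hd)]
    · rw [if_neg hd, if_neg (mt h.1 hd)]
  rw [← he (u m) q, ← he x q]
  rcases hn with hn | hn
  · exact iff_of_true (hn hm) (hn hself)
  · rw [eq_empty_iff_forall_notMem] at hn
    exact iff_of_false (fun h => hn _ ⟨hm, h⟩) fun h => hn _ ⟨hself, h⟩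

/-- The rows of `greedyStages (addBoundaries P)` converge in the jump topology to a 1-generic point
that avoids all closed sets with the negative names in `lim P`. -/
theorem exists_tendsto_greedyStages {P Q : Baire} (hP : Tendsto (row P) atTop (𝓝 Q))
    (hQ : ∀ i, DenseName (row Q i)) : ∃ x : Cantor, OneGenericIn zeroPoint x ∧
      (∀ i, ∃ j, x ∈ ball (row Q i j)) ∧
      Tendsto (row (greedyStages (addBoundaries P))) atTop (𝓝 x.toBaire) ∧
      Tendsto (row (greedyStages (addBoundaries P))) atTop (@nhds Baire jumpTopology x.toBaire) := by
  obtain ⟨W, hW⟩ := exists_isGreedy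
    (denseName_interleave hQ (denseName_boundaryName fun _ => 0))
  have hlim := hW.tendsto_greedyStages (tendsto_addBoundaries hP)
  have hgen : OneGenericIn zeroPoint (greedyPoint W) := by
    refine oneGenericIn_iff_boundaryName.2 fun i => ?_
    have := hW.exists_mem_ball (2 * i + 1)
    rwa [row_interleave_odd] at this
  refine ⟨greedyPoint W, hgen, fun i => ?_, hlim, ?_⟩
  · have := hW.exists_mem_ball (2 * i)
    rwa [row_interleave_even] at this
  · have hrow : row (greedyStages (addBoundaries P)) = fun n =>
        (pad (boundedGreedy (row (addBoundaries P) n) n n)).toBaire := by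
      funext n k
      simp only [row, greedyStages, Nat.unpair_pair]
      rfl
    rw [hrow] at hlim ⊢
    exact hgen.tendsto_jump hlim

theorem preprocesses_greedyStages :
    Preprocesses (fun P => greedyStages (addBoundaries P)) BCT0.jump limJ := by
  rintro P A ⟨Q, hQ, hQA⟩ hA
  obtain ⟨x, -, hx, hlim, hjump⟩ :=
    exists_tendsto_greedyStages hQ fun i => (denseName_iff (hQA i)).2 (hA i)
  refine ⟨_, rfl, ⟨_, hjump⟩, fun r (y : Baire) hy hr => ⟨x, ?_, ?_⟩⟩
  · exact mem_bctFun_val.2 fun i => (notMem_iff_of_isName (hQA i)).2 (hx i)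
  · obtain rfl : r = y := hr
    exact tendsto_nhds_unique hy hlim

/-! ### Separations -/

/-- A 1-generic point is not computable: otherwise the complement of the point would be c.e. open,
and it is dense. -/
theorem OneGenericIn.not_computable {q x : Cantor} (h : OneGenericIn q x) : ¬ Computable x := by
  intro hx
  -- `τ` has length `2 * b + 1` and ends with an entry different from `x b`; the lengths that are
  -- even are ruled out by the default value.
  let R : List ℕ → Prop := fun τ =>
    τ[2 * (τ.length / 2)]?.getD (x (τ.length / 2)).toNat ≠ (x (τ.length / 2)).toNat
  have hl : Computable fun τ : List ℕ => τ.length / 2 :=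
    (Primrec.nat_div.comp Primrec.list_length (Primrec.const 2)).to_comp
  have hx' : Computable fun τ : List ℕ => (x (τ.length / 2)).toNat :=
    primrec_toNat.to_comp.comp (hx.comp hl)
  have hg : Computable fun τ : List ℕ =>
      τ[2 * (τ.length / 2)]?.getD (x (τ.length / 2)).toNat :=
    Computable.option_getD (Computable.list_getElem?.comp Computable.id
      (Primrec.nat_double.to_comp.comp hl)) hx'
  have hR : ComputablePred R :=
    ComputablePred.not ⟨inferInstance, Primrec.eq.decide.to_comp.comp hg hx'⟩
  obtain ⟨e, he⟩ := exists_index hR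
  have hmem : ∀ y, y ∈ ceOpen q e ↔ y ≠ x := by
    intro y
    change (phi e _ 0).Dom ↔ _
    rw [he]
    constructor
    · rintro ⟨k, hk⟩ rfl
      refine hk ?_
      rw [length_initSeg, getElem?_initSeg]
      split_ifs
      · simp [pair, Cantor.toBaire]
      · rfl
    · intro hne
      obtain ⟨b, hb⟩ := Function.ne_iff.1 hne
      refine ⟨2 * b + 1, ?_⟩
      have h2 : (2 * b + 1) / 2 = b := by omega
      change (initSeg _ (2 * b + 1))[2 * ((initSeg _ (2 * b + 1)).length / 2)]?.getD _ ≠ _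
      rw [length_initSeg, h2, getElem?_initSeg, if_pos (Nat.lt_succ_self _), Option.getD_some]
      simpa [pair, Cantor.toBaire] using fun h => hb (toNat_injective h)
  have hxx := h.mem_of_dense (e := e) fun w => by
    by_cases hp : pad w = x
    · refine ⟨pad (w ++ [true]), wordBall_anti (List.prefix_append _ _) (pad_mem_wordBall _),
        (hmem _).2 fun hp' => ?_⟩
      have := congrFun (hp'.trans hp.symm) w.length
      simp [pad] at this
    · exact ⟨pad w, pad_mem_wordBall w, (hmem _).2 hp⟩
  exact (hmem x).1 hxx rfl

theorem computable_toBaire_iff {x : Cantor} : Computable x.toBaire ↔ Computable x := by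
  constructor
  · intro h
    have hb : Primrec fun n : ℕ => decide (n = 1) :=
      (Primrec.eq.comp Primrec.id (Primrec.const 1)).decide
    refine (hb.to_comp.comp h).of_eq fun n => ?_
    cases hx : x n <;> simp [Cantor.toBaire, hx]
  · exact fun h => primrec_toNat.to_comp.comp h

/-- A realizer of `g` may be chosen so that its values have an additional property `S`, if each instance
has a solution with this property. -/
theorem exists_realizer {g : Problem} {S : Baire → Baire → Prop}
    (hS : ∀ q x, g.inRep.IsName q x → x ∈ g.f.dom →
      ∃ r, S q r ∧ ∃ y ∈ g.f.val x, g.outRep.IsName r y) :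
    ∃ G, Realizes G g ∧ ∀ q, ∀ r ∈ G q, S q r := by
  let T : Baire → Baire → Prop := fun q r => S q r ∧
    ∃ x, g.inRep.IsName q x ∧ x ∈ g.f.dom ∧ ∃ y ∈ g.f.val x, g.outRep.IsName r y
  refine ⟨fun q => ⟨∃ r, T q r, fun h => h.choose⟩, fun q x hq hx => ?_, ?_⟩
  · obtain ⟨r, hr, hy⟩ := hS q x hq hx
    have h : ∃ r, T q r := ⟨r, hr, x, hq, hx, hy⟩
    obtain ⟨-, x', hx', -, hy'⟩ := h.choose_spec
    obtain rfl := g.inRep.unique hq hx'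
    exact ⟨_, ⟨h, rfl⟩, hy'⟩
  · rintro q r ⟨h, rfl⟩
    exact h.choose_spec.1

theorem not_oneGEN_leW_BCT0 : ¬ LeW oneGEN BCT0 := by
  rintro ⟨K, H, hK, hH, h⟩
  -- The greedy construction makes sure that `G` maps computable names to computable points.
  obtain ⟨G, hG, hGc⟩ := exists_realizer (g := BCT0) (S := fun q r => Computable q → Computable r)
    fun q A hq hA => by
      obtain ⟨W, hW⟩ := exists_isGreedy fun i => (denseName_iff (hq i)).2 (hA i)
      refine ⟨(greedyPoint W).toBaire,
        fun hc => computable_toBaire_iff.2 (hW.computable_greedyPoint hc), greedyPoint W,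
          mem_bctFun_val.2 fun i => (notMem_iff_of_isName (hq i)).2 (hW.exists_mem_ball i), rfl⟩
  obtain ⟨s, hs, x, hx, hsx⟩ := h G hG zeroPoint.toBaire zeroPoint rfl (mem_univ _)
  simp only [Part.mem_bind_iff] at hs
  obtain ⟨q, hq, r, hr, hs⟩ := hs
  have h0 : Computable zeroPoint.toBaire := Computable.const 0
  have hrc := hGc q r hr (hK.computable_value h0 hq)
  have hsc := hH.computable_value (computable_pair h0 hrc) hs
  have hsx' : s = Cantor.toBaire x := hsx
  exact OneGenericIn.not_computable (q := zeroPoint) hx (computable_toBaire_iff.1 (hsx' ▸ hsc))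

/-- The points `x` for which the computation of `y` with the oracle `⟨p, x⟩` gives a wrong value. -/
def wrongSet (e : ℕ) (p y : Baire) : Set Cantor :=
  {x | ∃ n, ∃ a ∈ phi e (pair p x.toBaire) n, a ≠ y n}

theorem exists_prefix_phi {e n a : ℕ} {p : Baire} {x : Cantor} (h : a ∈ phi e (pair p x.toBaire) n) :
    ∃ k, ∀ z ∈ wordBall (prefixOf x k), a ∈ phi e (pair p z.toBaire) n := by
  obtain ⟨k, hk⟩ := phi_use h
  refine ⟨k, fun z hz => hk _ fun m hm => ?_⟩
  rw [wordBall_prefixOf] at hz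
  have : z (m / 2) = x (m / 2) := hz _ ((Nat.div_le_self m 2).trans_lt hm)
  simp only [pair, Cantor.toBaire, this]

theorem isOpen_wrongSet (e : ℕ) (p y : Baire) : IsOpen (wrongSet e p y) := by
  refine isOpen_iff_mem_nhds.2 fun x ⟨n, a, ha, hne⟩ => ?_
  obtain ⟨k, hk⟩ := exists_prefix_phi ha
  exact mem_of_superset ((isOpen_wordBall _).mem_nhds (self_mem_wordBall_prefixOf x k))
    fun z hz => ⟨n, a, hk z hz, hne⟩

/-- If `y` is computed from `⟨p, x⟩` with `p` computable, and if no extension of some initial segment of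
`x` leads to a wrong value, then `y` is computable: values can be searched for among the
extensions. -/
theorem computable_of_disjoint_wrongSet {e k : ℕ} {p y : Baire} {x : Cantor} (hp : Computable p)
    (hy : ∀ n, y n ∈ phi e (pair p x.toBaire) n)
    (hx : ∀ z ∈ wordBall (prefixOf x k), z ∉ wrongSet e p y) : Computable y := by
  let z : ℕ → Cantor := fun m => pad (prefixOf x k ++ boolWord m)
  have hz : Computable₂ fun m => (z m).toBaire :=
    primrec_toNat.to_comp.comp ((Primrec.list_getD false).comp (Primrec.list_append.comp
      (Primrec.const (prefixOf x k)) (primrec_boolWord.comp Primrec.fst)) Primrec.snd).to_comp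
  have hP : Computable₂ fun m => pair p (z m).toBaire := by
    have h2 : Computable fun a : ℕ × ℕ => a.2 / 2 :=
      (Primrec.nat_div.comp Primrec.snd (Primrec.const 2)).to_comp
    have hm : Computable fun a : ℕ × ℕ => decide (a.2 % 2 = 0) :=
      (Primrec.eq.comp (Primrec.nat_mod.comp Primrec.snd (Primrec.const 2))
        (Primrec.const 0)).decide.to_comp
    refine (Computable.cond hm (hp.comp h2) (hz.comp Computable.fst h2)).of_eq fun a => ?_
    by_cases h : a.2 % 2 = 0 <;> simp [pair, h]
  obtain ⟨c, hc⟩ := Nat.Partrec.Code.exists_code.1 (Partrec.nat_iff.1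
    ((phi_partrec hP e).comp (Computable.fst.comp Computable.unpair)
      (Computable.snd.comp Computable.unpair)))
  have hc' : ∀ m n, c.eval (Nat.pair m n) = phi e (pair p (z m).toBaire) n := by
    intro m n
    refine (congrFun hc (Nat.pair m n)).trans ?_
    simp only [Nat.unpair_pair]
  have hS : Computable₂ fun n s : ℕ => evaln s.unpair.2 c (Nat.pair s.unpair.1 n) := by
    have hu : Computable fun a : ℕ × ℕ => a.2.unpair := Computable.unpair.comp Computable.snd
    exact Nat.Partrec.Code.primrec_evaln.to_comp.comp
      (((Computable.snd.comp hu).pair (Computable.const c)).pair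
        (Primrec₂.natPair.to_comp.comp (Computable.fst.comp hu) Computable.fst))
  refine Partrec.of_eq_tot (Partrec.rfindOpt hS) fun n => ?_
  have hval : ∀ s a : ℕ, a ∈ evaln s.unpair.2 c (Nat.pair s.unpair.1 n) → a = y n := by
    intro s a ha
    have ha' := Nat.Partrec.Code.evaln_sound ha
    rw [hc'] at ha'
    by_contra hne
    exact hx (z s.unpair.1) (wordBall_anti (List.prefix_append _ _) (pad_mem_wordBall _))
      ⟨n, a, ha', hne⟩
  have hdom : (Nat.rfindOpt fun s : ℕ => evaln s.unpair.2 c (Nat.pair s.unpair.1 n)).Dom := by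
    obtain ⟨l, hl⟩ := exists_prefix_phi (hy n)
    obtain ⟨t, ht⟩ := prefixOf_prefix_of_le x (le_max_left k l)
    have hmem : y n ∈ c.eval (Nat.pair (Encodable.encode t) n) := by
      rw [hc']
      refine hl _ (wordBall_anti (prefixOf_prefix_of_le x (le_max_right k l)) ?_)
      change pad (prefixOf x k ++ boolWord (Encodable.encode t)) ∈ _
      rw [boolWord_encode, ht]
      exact pad_mem_wordBall _
    obtain ⟨s, hs⟩ := Nat.Partrec.Code.evaln_complete.1 hmem
    exact Nat.rfindOpt_dom.2 ⟨Nat.pair (Encodable.encode t) s, y n, by simpa using hs⟩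
  obtain ⟨a, ha⟩ := Part.dom_iff_mem.1 hdom
  obtain ⟨s, hs⟩ := Nat.rfindOpt_spec ha
  rwa [← hval s a hs]

theorem exists_mem_bctFun_val_notMem_frontier {A : ℕ → TopologicalSpace.Closeds Cantor}
    (hA : A ∈ bctFun.dom) {V : Set Cantor} (hV : IsOpen V) :
    ∃ x ∈ bctFun.val A, x ∉ frontier V := by
  obtain ⟨x, hx⟩ := bctFun.nonempty
    (fun i => Nat.casesOn i ⟨frontier V, isClosed_frontier⟩ A) fun i => by
      cases i with
      | zero =>
        change interior (frontier V) = ∅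
        rw [← frontier_compl]
        exact interior_frontier hV.isClosed_compl
      | succ i => exact hA i
  rw [mem_bctFun_val] at hx
  exact ⟨x, mem_bctFun_val.2 fun i => hx (i + 1), hx 0⟩

theorem not_limJ_leW_BCT0_jump : ¬ LeW limJ BCT0.jump := by
  rintro ⟨K, H, hK, hH, h⟩
  -- `1` codes the ball `2^ℕ`, so the constant sequence is a name of a sequence of empty sets.
  have hconst : Tendsto (row fun _ => 1) atTop (𝓝 fun _ => 1) := tendsto_const_nhds
  obtain ⟨x, hx, -, hlim, hjump⟩ := exists_tendsto_greedyStages hconst fun i w =>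
    ⟨pad w, pad_mem_wordBall w, 0, mem_ball.2 ⟨[], ballWord_encode_succ [], mem_wordBall.2 (by simp)⟩⟩
  set p : Baire := greedyStages (addBoundaries fun _ => 1) with hp
  have hpc : Computable p :=
    prefixComputable_greedyStages.computable_value
      (prefixComputable_addBoundaries.computable_value (Computable.const 1))
  obtain ⟨e, he⟩ := hH
  have hV := isOpen_wrongSet e p x.toBaire
  obtain ⟨G, hG, hGS⟩ := exists_realizer (g := BCT0.jump)
    (S := fun _ r => ∃ z : Cantor, r = z.toBaire ∧ z ∉ frontier (wrongSet e p x.toBaire))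
    fun q A hq hA => by
      obtain ⟨z, hz, hzV⟩ := exists_mem_bctFun_val_notMem_frontier hA hV
      exact ⟨z.toBaire, ⟨z, rfl, hzV⟩, z, hz, rfl⟩
  obtain ⟨s, hs, y, hy, hsy⟩ := h G hG p p rfl ⟨_, hjump⟩
  obtain rfl : s = y := hsy
  obtain rfl : s = x.toBaire := tendsto_nhds_unique hy hlim
  simp only [Part.mem_bind_iff] at hs
  obtain ⟨q, -, r, hr, hs⟩ := hs
  obtain ⟨z, rfl, hz⟩ := hGS q r hr
  have hval := he _ _ hs
  have hzV : z ∉ wrongSet e p x.toBaire := fun ⟨n, a, ha, hne⟩ =>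
    hne (Part.mem_unique ha (hval n))
  have hzc : z ∈ (closure (wrongSet e p x.toBaire))ᶜ := fun hc => hz (by
    rw [hV.frontier_eq]; exact ⟨hc, hzV⟩)
  obtain ⟨k, hk⟩ := exists_wordBall_subset isClosed_closure.isOpen_compl hzc
  exact hx.not_computable (computable_toBaire_iff.1 (computable_of_disjoint_wrongSet hpc hval
    fun v hv hvV => hk hv (subset_closure hvV)))

end Weihrauch

theorem corollary9p6 :
    Weihrauch.LeSW Weihrauch.BCT0 Weihrauch.oneGEN ∧
    Weihrauch.LeSW Weihrauch.oneGEN Weihrauch.BCT2 ∧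
    Weihrauch.EquivSW Weihrauch.BCT2 Weihrauch.BCT0.jump ∧
    Weihrauch.LeSW Weihrauch.BCT0.jump Weihrauch.limJ ∧
    Weihrauch.LtW Weihrauch.BCT0 Weihrauch.oneGEN ∧
    Weihrauch.LtW Weihrauch.BCT0.jump Weihrauch.limJ := by
  have h1 := Weihrauch.preprocesses_graph.leSW_and_leW Weihrauch.prefixComputable_graph
  have h2 := (Weihrauch.preprocesses_boundaries.comp
    Weihrauch.preprocesses_unstablePoints).leSW_and_leW
      (Weihrauch.prefixComputable_unstablePoints.comp Weihrauch.prefixComputable_boundaries)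
  have h3 := Weihrauch.preprocesses_emptyBalls.leSW_and_leW Weihrauch.prefixComputable_emptyBalls
  have h4 := Weihrauch.preprocesses_unstablePoints.leSW_and_leW
    Weihrauch.prefixComputable_unstablePoints
  have h5 := Weihrauch.preprocesses_greedyStages.leSW_and_leW
    (Weihrauch.prefixComputable_greedyStages.comp Weihrauch.prefixComputable_addBoundaries)
  exact ⟨h1.1, h2.1, ⟨h3.1, h4.1⟩, h5.1, ⟨h1.2, Weihrauch.not_oneGEN_leW_BCT0⟩,
    ⟨h5.2, Weihrauch.not_limJ_leW_BCT0_jump⟩⟩
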